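/- Setting. Let $N\ge 1$, let $x_0<\dots<x_N$ be the Gauss–Lobatto nodes on $[-1,1]$ ($\pm1$ and the zeros of $L_N'$, $L_N$ the Legendre polynomial), $w_j=\frac{2}{N(N+1)}L_N(x_j)^{-2}$ the quadrature weights, $\ell_n$ the Lagrange polynomials and $D_{jn}=\ell_n'(x_j)$. On the reference cube use the tensor-product nodes; $(\cdot,\cdot)_N$ and $\int_{\partial E,N}$ denote Gauss–Lobatto quadrature on the cube and on its faces, and $\vec\nabla_\xi$ acts on nodal values through $D$. A mesh consists of finitely many hexahedral elements with nodal Jacobians $J>0$ and nodal volume-weighted contravariant vectors $J\vec a^{\,d}$, $d=1,2,3$, satisfying the discrete metric identities $\sum_d \partial_{\xi^d}\mathbb I^N(J\vec a^{\,d})=\vec 0$ at all nodes. On a face $\xi^d=\pm1$ put $\hat s=|J\vec a^{\,d}|$ and $\vec n=\pm J\vec a^{\,d}/\hat s$. Every element face is either a physical boundary face or is identified node by node with exactly one other element face (an interior face, with sides $L$ and $R$; periodically identified faces count as interior), and there $\hat s_L=\hat s_R$, $\vec n:=\vec n_L=-\vec n_R$. Write $[[a]]=a_R-a_L$, $\{\{a\}\}=\frac12(a_L+a_R)$.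 Let $\gamma>1$, $\mathrm{Pr},\mathrm M_\infty,\mathrm{Re}>0$ and let the viscosity satisfy $\mu>0$. For states $u=(\rho,\rho\vec v,\rho E)$ with $\rho,p>0$, where $p=(\gamma-1)(\rho E-\frac12\rho|\vec v|^2)$, let $f_i$ be the Euler fluxes, $s=-\rho(\ln p-\gamma\ln\rho)/(\gamma-1)$ the entropy, $\vec f^{S}=s\vec v$ the entropy flux, $w=\partial s/\partial u$ the entropy variables, and $f^v_i$ the compressible Navier–Stokes viscous fluxes (with $\tau_{ij}=\mu(\partial_i v_j+\partial_j v_i)-\frac23\mu\,(\nabla\cdot\vec v)\,\delta_{ij}$, conductivity $\mu/((\gamma-1)\mathrm{Pr}\,\mathrm M_\infty^2)$, $T=\gamma\mathrm M_\infty^2p/\rho$), written as functions of $u$ and of the gradient of $w$ by the chain rule. Let $F^{ec}=(F^{ec}_1,F^{ec}_2,F^{ec}_3)$ be a two-point flux that is symmetric, consistent ($F_i^{ec}(u,u)=f_i(u)$) and satisfies Tadmor's condition $[[w]]^TF^{ec}_i(u_L,u_R)=[[w^Tf_i-f^S_i]]$ for $i=1,2,3$ and all $u_L,u_R$ with positive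 density and pressure. Scheme. On $[0,T]$, $T>0$, let the nodal values $U(t)$, differentiable in time and with $\rho,p>0$, and $Q(t)$ satisfy on every element, for all polynomial test functions $\varphi$ and $\vartheta$ of degree at most $N$ in each direction, $$(JU_t,\varphi)_N+(\mathbb D\cdot\tilde F^{ec},\varphi)_N+\int_{\partial E,N}\varphi^T\{F_n^*-F_n\}\hat s\,dS=\tfrac1{\mathrm{Re}}(\mathbb D^s\cdot\tilde F^v,\varphi)_N+\tfrac1{\mathrm{Re}}\int_{\partial E,N}\varphi^T\{F_n^{v,*}-F_n^v\}\hat s\,dS,$$ $$(JQ,\vartheta)_N=\int_{\partial E,N}W^{*,T}(\vartheta\cdot\vec n)\hat s\,dS-(W,\vec\nabla_\xi\cdot\mathbb I^N(\mathcal M^T\vartheta))_N .$$ Here $W=w(U)$, $F_i=f_i(U)$, $F^v=f^v(U,Q)$, $\vec F^S=\vec f^S(U)$; the subscript $n$ denotes the component along the outward normal; $(\mathcal M^T\vartheta)^d=\sum_i (Ja^d)_i\vartheta_i$, $\mathbb D^s\cdot\tilde F^v=\vec\nabla_\xi\cdot\mathbb I^N(\mathcal M^TF^v)$; and at each node $I$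 $$(\mathbb D\cdot\tilde F^{ec})_I=\sum_{d=1}^3 2\sum_{m=0}^N D_{I_dm}\,F^{ec}(U_I,U_{I[d\to m]})\cdot\tfrac12\left(J\vec a^{\,d}_I+J\vec a^{\,d}_{I[d\to m]}\right),$$ where $I[d\to m]$ is $I$ with its $d$-th index replaced by $m$. On interior faces $F_n^*=F^{ec}(U_L,U_R)\cdot\vec n-\frac{\lambda_{\max}}2[[W]]$ with some $\lambda_{\max}\ge0$ at each face node, and $W^*=\{\{W\}\}$, $F_n^{v,*}=\{\{F^v\}\}\cdot\vec n$ (BR1); on boundary faces $F_n^*,W^*,F_n^{v,*}$ are arbitrary prescribed values. Claim. The total discrete entropy $\overline S(t)=\sum_{\text{elements}}(J\,s(U(t)),1)_N$ is differentiable on $[0,T]$ and, for all $t\in[0,T]$, $$\frac{d}{dt}\overline S\le \mathrm{PBT}-\sum_{\text{interior faces}}\int_N\frac{\lambda_{\max}}2[[W]]^T[[W]]\,\hat s\,dS,$$ $$\mathrm{PBT}=\sum_{\text{boundary faces}}\int_N\Big\{-\vec F^S\cdot\vec n+\tfrac1{\mathrm{Re}}W^TF^v_n-W^T(F_n^*-F_n)+\tfrac1{\mathrm{Re}}\big[(W^*-W)^TF^v_n+W^T(F_n^{v,*}-F^v_n)\big]\Big\}\hat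 s\,dS .$$ In particular, if at time $t$ the boundary flux is $F_n^*=F^{ec}(U,U_{ext})\cdot\vec n-\frac{\lambda_{\max}}2[[W]]$ with exterior states $U_{ext}$ and $[[W]]=w(U_{ext})-W$, the term $-W^T(F_n^*-F_n)$ equals $-W^T(F^{ec}(U,U_{ext})\cdot\vec n-F_n)+\frac{\lambda_{\max}}2W^T[[W]]$. If $\mathrm{PBT}\le0$ for all $t\in[0,T]$, or if there are no physical boundary faces (periodic boundary conditions), then $\frac{d}{dt}\overline S\le0$ on $[0,T]$ and $\overline S(T)\le\overline S(0)$. -/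

import Mathlib

noncomputable section

namespace DGSEM

/-! ### One-dimensional spectral calculus -/

/-- Legendre polynomials, by the three-term recurrence
`L_{k+2} = (2k+3)/(k+2) x L_{k+1} - (k+1)/(k+2) L_k`. -/
def legendre : ℕ → Polynomial ℝ
  | 0 => 1
  | 1 => Polynomial.X
  | k + 2 =>
      Polynomial.C ((2 * (k : ℝ) + 3) / ((k : ℝ) + 2)) * Polynomial.X * legendre (k + 1)
        - Polynomial.C (((k : ℝ) + 1) / ((k : ℝ) + 2)) * legendre k

/-- `x 0 < x 1 < ... < x N` are the Gauss-Lobatto nodes: `-1`, `1` and the zeros of `L_N'`. -/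
structure IsGaussLobatto (N : ℕ) (x : Fin (N + 1) → ℝ) : Prop where
  strictMono : StrictMono x
  range_iff : ∀ y : ℝ, (∃ j, x j = y) ↔
    y = -1 ∨ y = 1 ∨ (Polynomial.derivative (legendre N)).eval y = 0

variable {N : ℕ}

/-- Gauss-Lobatto quadrature weights. -/
def weight (x : Fin (N + 1) → ℝ) (j : Fin (N + 1)) : ℝ :=
  2 / ((N : ℝ) * ((N : ℝ) + 1)) * (1 / ((legendre N).eval (x j)) ^ 2)

/-- The derivative matrix `D_{jn} = ℓ_n'(x_j)` of the Lagrange basis on the nodes `x`. -/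
def derivMatrix (x : Fin (N + 1) → ℝ) (j n : Fin (N + 1)) : ℝ :=
  (Polynomial.derivative (Lagrange.basis Finset.univ x n)).eval (x j)

/-! ### Tensor-product nodes on the reference cube and on its faces -/

/-- Multi-index `(i, j, k)` of a Gauss-Lobatto node of the reference element `[-1,1]^3`.
A polynomial of degree at most `N` in each direction is represented by its nodal values. -/
abbrev Node (N : ℕ) := Fin 3 → Fin (N + 1)

/-- Index of a node on a face of the cube. -/
abbrev FaceNode (N : ℕ) := Fin 2 → Fin (N + 1)

/-- A face of the reference cube: the coordinate direction `dir` and the side,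
`ξ^dir = 1` if `upper` and `ξ^dir = -1` otherwise. -/
structure LocalFace where
  dir : Fin 3
  upper : Bool
deriving DecidableEq, Fintype

/-- The volume node that sits at a face node. -/
def LocalFace.node (φ : LocalFace) (q : FaceNode N) : Node N :=
  φ.dir.insertNth (α := fun _ => Fin (N + 1)) (if φ.upper then Fin.last N else 0) q

/-- Sign of the outward reference normal. -/
def LocalFace.sign (φ : LocalFace) : ℝ := if φ.upper then 1 else -1

/-- Tensor-product volume weights `w_i w_j w_k`. -/
def volWeight (x : Fin (N + 1) → ℝ) (I : Node N) : ℝ := ∏ d, weight x (I d)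

/-- Tensor-product surface weights. -/
def surfWeight (x : Fin (N + 1) → ℝ) (q : FaceNode N) : ℝ := ∏ e, weight x (q e)

/-- Spectral partial derivative in the reference direction `d`, at the node `I`. -/
def pderiv (x : Fin (N + 1) → ℝ) (d : Fin 3) (f : Node N → ℝ) (I : Node N) : ℝ :=
  ∑ m, derivMatrix x (I d) m * f (Function.update I d m)

/-! ### States, fluxes and entropy of the compressible Navier-Stokes equations -/

/-- State vectors `(ρ, ρ v₁, ρ v₂, ρ v₃, ρ E)`; also entropy variables and fluxes. -/
abbrev State := Fin 5 → ℝ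

/-- Block vectors: one state vector for each Cartesian direction. -/
abbrev BlockVec := Fin 3 → State

/-- Position of the `i`-th momentum (or velocity-like) component in a state vector. -/
def mom (i : Fin 3) : Fin 5 := i.succ.castSucc

/-- Contraction `aᵀ b` of two state vectors. -/
def sdot (a b : State) : ℝ := ∑ c, a c * b c

/-- Dot product `F · n` of a block vector and a space vector, a state vector. -/
def ndot (F : BlockVec) (n : Fin 3 → ℝ) : State := fun c => ∑ i, n i * F i c

/-- Physical parameters: ratio of specific heats, Prandtl, Mach and Reynolds numbers, and the
(possibly state-dependent) viscosity. -/
structure Gas where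
  γ : ℝ
  prandtl : ℝ
  mach : ℝ
  reynolds : ℝ
  μ : State → ℝ

def velocity (u : State) (i : Fin 3) : ℝ := u (mom i) / u 0

/-- `|v|²`. -/
def speedSq (u : State) : ℝ := ∑ i, velocity u i ^ 2

/-- Pressure of an ideal gas, from `ρ E = p / (γ - 1) + ρ |v|² / 2`. -/
def pressure (g : Gas) (u : State) : ℝ := (g.γ - 1) * (u 4 - u 0 * speedSq u / 2)

/-- Positive density and pressure. -/
def Admissible (g : Gas) (u : State) : Prop := 0 < u 0 ∧ 0 < pressure g u

/-- The range of the physical parameters. -/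
structure Gas.Valid (g : Gas) : Prop where
  one_lt_γ : 1 < g.γ
  prandtl_pos : 0 < g.prandtl
  mach_pos : 0 < g.mach
  reynolds_pos : 0 < g.reynolds
  μ_pos : ∀ u, Admissible g u → 0 < g.μ u

/-- Specific total enthalpy `H = E + p / ρ`. -/
def enthalpy (g : Gas) (u : State) : ℝ := u 4 / u 0 + pressure g u / u 0

/-- The advective (Euler) fluxes `f₁, f₂, f₃`. -/
def advFlux (g : Gas) (u : State) : BlockVec := fun i =>
  ![u 0 * velocity u i,
    u 0 * velocity u i * velocity u 0 + (if i = 0 then pressure g u else 0),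
    u 0 * velocity u i * velocity u 1 + (if i = 1 then pressure g u else 0),
    u 0 * velocity u i * velocity u 2 + (if i = 2 then pressure g u else 0),
    u 0 * velocity u i * enthalpy g u]

/-- Physical entropy `ς = ln p - γ ln ρ`. -/
def physEntropy (g : Gas) (u : State) : ℝ := Real.log (pressure g u) - g.γ * Real.log (u 0)

/-- Mathematical entropy `s = - ρ ς / (γ - 1)`. -/
def entropy (g : Gas) (u : State) : ℝ := -(u 0 * physEntropy g u) / (g.γ - 1)

/-- Entropy flux `s v`. -/
def entropyFlux (g : Gas) (u : State) (i : Fin 3) : ℝ := entropy g u * velocity u i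

/-- Entropy variables `w = ∂s/∂u`. -/
def entropyVars (g : Gas) (u : State) : State :=
  ![(g.γ - physEntropy g u) / (g.γ - 1) - u 0 * speedSq u / (2 * pressure g u),
    u 0 * velocity u 0 / pressure g u,
    u 0 * velocity u 1 / pressure g u,
    u 0 * velocity u 2 / pressure g u,
    -u 0 / pressure g u]

/-- Velocity gradient `∂v_j/∂x_i` belonging to the gradient `Q` of the entropy variables, i.e. the
quotient rule applied to `v_j = - w_{1+j} / w_5`. -/
def velGrad (g : Gas) (u : State) (Q : BlockVec) (i j : Fin 3) : ℝ :=
  -(Q i (mom j) * entropyVars g u 4 - entropyVars g u (mom j) * Q i 4) / entropyVars g u 4 ^ 2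

/-- Temperature gradient `∂T/∂x_i` belonging to the gradient `Q` of the entropy variables, i.e. the
quotient rule applied to `T = γ M² p / ρ = - γ M² / w_5`. -/
def tempGrad (g : Gas) (u : State) (Q : BlockVec) (i : Fin 3) : ℝ :=
  g.γ * g.mach ^ 2 * Q i 4 / entropyVars g u 4 ^ 2

/-- Viscous stress tensor. -/
def stress (g : Gas) (u : State) (Q : BlockVec) (i j : Fin 3) : ℝ :=
  g.μ u * (velGrad g u Q i j + velGrad g u Q j i)
    - 2 / 3 * g.μ u * (if i = j then ∑ l, velGrad g u Q l l else 0)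

/-- Heat conductivity `λ = μ / ((γ - 1) Pr M²)`. -/
def conductivity (g : Gas) (u : State) : ℝ :=
  g.μ u / ((g.γ - 1) * g.prandtl * g.mach ^ 2)

/-- The viscous fluxes, as functions of the state and of the gradient of the entropy variables. -/
def viscFlux (g : Gas) (u : State) (Q : BlockVec) : BlockVec := fun i =>
  ![0, stress g u Q i 0, stress g u Q i 1, stress g u Q i 2,
    (∑ j, velocity u j * stress g u Q i j) + conductivity g u * tempGrad g u Q i]

/-- A two-point flux in each Cartesian direction, symmetric, consistent with the advective flux and
entropy conservative: `[[w]]ᵀ f^ec(u_L, u_R) = [[wᵀ f - f^S]]` with `[[a]] = a_R - a_L`. -/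
structure IsEntropyConservative (g : Gas) (Fec : State → State → BlockVec) : Prop where
  symm : ∀ uL uR, Admissible g uL → Admissible g uR → Fec uL uR = Fec uR uL
  consistent : ∀ u, Admissible g u → Fec u u = advFlux g u
  tadmor : ∀ uL uR, Admissible g uL → Admissible g uR → ∀ i,
    sdot (entropyVars g uR - entropyVars g uL) (Fec uL uR i) =
      (sdot (entropyVars g uR) (advFlux g uR i) - entropyFlux g uR i)
        - (sdot (entropyVars g uL) (advFlux g uL i) - entropyFlux g uL i)

/-! ### Curvilinear meshes -/

/-- A symmetry of the square: exchange of the two coordinates and reflections. It describes how the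
nodes of the two sides of an interface are identified. -/
structure SquareSymm where
  perm : Equiv.Perm (Fin 2)
  flip : Fin 2 → Bool

/-- Action of a symmetry of the square on face nodes (Gauss-Lobatto nodes are symmetric about 0, so
a reflection reverses the index). -/
def SquareSymm.act (σ : SquareSymm) : FaceNode N ≃ FaceNode N :=
  (σ.perm.arrowCongr (Equiv.refl (Fin (N + 1)))).trans
    (Equiv.piCongrRight fun e => if σ.flip e then Fin.revPerm else Equiv.refl (Fin (N + 1)))

/-- A mesh of curved hexahedra with elements `K`, interior faces `Fi` (for a periodic
problem these include the identified periodic faces) and physical boundary faces `Fb`.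
Each of the six faces of each element is the left side of an interior face, the right side of an
interior face, or a boundary face, and it is exactly one of these. -/
structure Mesh (N : ℕ) (K Fi Fb : Type*) where
  faces : (Fi ⊕ Fi) ⊕ Fb ≃ K × LocalFace
  /-- node identification, from the left side to the right side of an interior face -/
  glue : Fi → SquareSymm
  /-- nodal values of the Jacobian of the element mapping -/
  J : K → Node N → ℝ
  /-- nodal values of the volume-weighted contravariant vectors: `Ja k I d n` is the Cartesian
  component `n` of `J a^d` -/
  Ja : K → Node N → Fin 3 → Fin 3 → ℝ

variable {K Fi Fb : Type*}

namespace Mesh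

/-- Surface element `ŝ = |J a^d|` at a face node. -/
def surfElem (m : Mesh N K Fi Fb) (kf : K × LocalFace) (q : FaceNode N) : ℝ :=
  Real.sqrt (∑ n, m.Ja kf.1 (kf.2.node q) kf.2.dir n ^ 2)

/-- Outward unit normal `± J a^d / |J a^d|` in physical space at a face node. -/
def normal (m : Mesh N K Fi Fb) (kf : K × LocalFace) (q : FaceNode N) : Fin 3 → ℝ :=
  fun n => kf.2.sign * m.Ja kf.1 (kf.2.node q) kf.2.dir n / m.surfElem kf q

def left (m : Mesh N K Fi Fb) (f : Fi) : K × LocalFace := m.faces (.inl (.inl f))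

def right (m : Mesh N K Fi Fb) (f : Fi) : K × LocalFace := m.faces (.inl (.inr f))

def bdry (m : Mesh N K Fi Fb) (b : Fb) : K × LocalFace := m.faces (.inr b)

/-- What lies on the other side of an element face at a face node: either an interior face, the
index of the point in the numbering of its left side, and the element and node on the other side;
or a physical boundary face. -/
def across (m : Mesh N K Fi Fb) (kf : K × LocalFace) (q : FaceNode N) :
    (Fi × FaceNode N × K × Node N) ⊕ Fb :=
  match m.faces.symm kf with
  | .inl (.inl f) =>
      .inl (f, q, (m.right f).1, (m.right f).2.node ((m.glue f).act q))
  | .inl (.inr f) =>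
      .inl (f, (m.glue f).act.symm q, (m.left f).1, (m.left f).2.node ((m.glue f).act.symm q))
  | .inr b => .inr b

/-- The normal at an interface only changes sign between the two sides, and the surface elements
agree. -/
def Conforming (m : Mesh N K Fi Fb) : Prop :=
  ∀ f q, m.surfElem (m.right f) ((m.glue f).act q) = m.surfElem (m.left f) q ∧
    m.normal (m.right f) ((m.glue f).act q) = -m.normal (m.left f) q

/-- Discrete metric identities: `∑_d ∂_{ξ^d} I^N(J a^d) = 0` at the nodes, in each Cartesian
component. -/
def MetricIdentities (m : Mesh N K Fi Fb) (x : Fin (N + 1) → ℝ) : Prop :=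
  ∀ k I n, ∑ d, pderiv x d (fun I' => m.Ja k I' d n) I = 0

/-- Contravariant block vector `Mᵀ F` in the element `k`. -/
def contra (m : Mesh N K Fi Fb) (k : K) (F : Node N → BlockVec) (I : Node N) : BlockVec :=
  fun d c => ∑ n, m.Ja k I d n * F I n c

/-- Standard spectral divergence `∇_ξ · I^N(Mᵀ F)` in the element `k`. -/
def stdDiv (m : Mesh N K Fi Fb) (x : Fin (N + 1) → ℝ) (k : K) (F : Node N → BlockVec)
    (I : Node N) : State :=
  fun c => ∑ d, pderiv x d (fun I' => m.contra k F I' d c) I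

/-- Split-form (flux differencing) divergence with a two-point volume flux. -/
def splitDiv (m : Mesh N K Fi Fb) (x : Fin (N + 1) → ℝ) (Fec : State → State → BlockVec)
    (k : K) (U : Node N → State) (I : Node N) : State :=
  fun c => ∑ d, 2 * ∑ j, derivMatrix x (I d) j *
    ∑ n, Fec (U I) (U (Function.update I d j)) n c *
      ((m.Ja k I d n + m.Ja k (Function.update I d j) d n) / 2)

end Mesh

/-- Discrete inner product on the reference element. -/
def ipN (x : Fin (N + 1) → ℝ) (F G : Node N → State) : ℝ :=
  ∑ I, volWeight x I * sdot (F I) (G I)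

/-- Surface quadrature `∫_{f,N} G ŝ dS` over one element face. -/
def faceInt (m : Mesh N K Fi Fb) (x : Fin (N + 1) → ℝ) (kf : K × LocalFace)
    (G : FaceNode N → ℝ) : ℝ :=
  ∑ q, surfWeight x q * G q * m.surfElem kf q

/-- Surface quadrature `∫_{∂E,N} G ŝ dS` over the boundary of the element `k`. -/
def surfInt (m : Mesh N K Fi Fb) (x : Fin (N + 1) → ℝ) (k : K)
    (G : LocalFace → FaceNode N → ℝ) : ℝ :=
  ∑ φ, faceInt m x (k, φ) (G φ)

/-! ### Numerical fluxes -/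

/-- Advective surface flux `F^ec(u_in, u_out) · n - (λ_max / 2) [[W]]`, where `n` points from the
inner to the outer state. -/
def surfaceFlux (g : Gas) (Fec : State → State → BlockVec) (lam : ℝ) (n : Fin 3 → ℝ)
    (uin uout : State) : State :=
  ndot (Fec uin uout) n - (lam / 2) • (entropyVars g uout - entropyVars g uin)

/-- Values of the numerical fluxes `F*_n`, `W*` and `F^{v,*}_n` at the physical boundary (with
respect to the outward normal), through which boundary conditions are imposed. -/
structure BoundaryData (N : ℕ) (Fb : Type*) where
  Fstar : Fb → FaceNode N → State
  Wstar : Fb → FaceNode N → State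
  Fvstar : Fb → FaceNode N → State

/-- Everything that determines the spatial discretization at one instant: `lam` is the estimate of
the fastest wave speed at the points of the interior faces. -/
structure Snapshot (N : ℕ) (K Fi Fb : Type*) where
  U : K → Node N → State
  Q : K → Node N → BlockVec
  lam : Fi → FaceNode N → ℝ
  bd : BoundaryData N Fb

namespace Snapshot

/-- Entropy variables at the nodes. -/
def W (z : Snapshot N K Fi Fb) (g : Gas) (k : K) (I : Node N) : State :=
  entropyVars g (z.U k I)

/-- Viscous fluxes at the nodes. -/
def Fv (z : Snapshot N K Fi Fb) (g : Gas) (k : K) (I : Node N) : BlockVec :=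
  viscFlux g (z.U k I) (z.Q k I)

/-- Trace of `U` on an element face. -/
def Utr (z : Snapshot N K Fi Fb) (kf : K × LocalFace) (q : FaceNode N) : State :=
  z.U kf.1 (kf.2.node q)

/-- Trace of `W` on an element face. -/
def Wtr (z : Snapshot N K Fi Fb) (g : Gas) (kf : K × LocalFace) (q : FaceNode N) : State :=
  z.W g kf.1 (kf.2.node q)

/-- Normal advective flux from the interior of the element. -/
def Fn (z : Snapshot N K Fi Fb) (g : Gas) (m : Mesh N K Fi Fb) (kf : K × LocalFace)
    (q : FaceNode N) : State :=
  ndot (advFlux g (z.Utr kf q)) (m.normal kf q)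

/-- Normal viscous flux from the interior of the element. -/
def Fvn (z : Snapshot N K Fi Fb) (g : Gas) (m : Mesh N K Fi Fb) (kf : K × LocalFace)
    (q : FaceNode N) : State :=
  ndot (z.Fv g kf.1 (kf.2.node q)) (m.normal kf q)

/-- Normal entropy flux from the interior of the element. -/
def entFluxN (z : Snapshot N K Fi Fb) (g : Gas) (m : Mesh N K Fi Fb) (kf : K × LocalFace)
    (q : FaceNode N) : ℝ :=
  ∑ i, entropyFlux g (z.Utr kf q) i * m.normal kf q i

/-- Advective numerical flux `F*_n` on an element face, with respect to its outward normal. -/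
def numF (z : Snapshot N K Fi Fb) (g : Gas) (Fec : State → State → BlockVec)
    (m : Mesh N K Fi Fb) (kf : K × LocalFace) (q : FaceNode N) : State :=
  match m.across kf q with
  | .inl (f, r, k', I') =>
      surfaceFlux g Fec (z.lam f r) (m.normal kf q) (z.Utr kf q) (z.U k' I')
  | .inr b => z.bd.Fstar b q

/-- `W* = {{W}}` (BR1) on interior faces. -/
def numW (z : Snapshot N K Fi Fb) (g : Gas) (m : Mesh N K Fi Fb) (kf : K × LocalFace)
    (q : FaceNode N) : State :=
  match m.across kf q with
  | .inl (_, _, k', I') => (1 / 2 : ℝ) • (z.Wtr g kf q + z.W g k' I')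
  | .inr b => z.bd.Wstar b q

/-- `F^{v,*}_n = {{F^v}} · n` (BR1) on interior faces. -/
def numFv (z : Snapshot N K Fi Fb) (g : Gas) (m : Mesh N K Fi Fb) (kf : K × LocalFace)
    (q : FaceNode N) : State :=
  match m.across kf q with
  | .inl (_, _, k', I') =>
      ndot ((1 / 2 : ℝ) • (z.Fv g kf.1 (kf.2.node q) + z.Fv g k' I')) (m.normal kf q)
  | .inr b => z.bd.Fvstar b q

/-- First equation of the split-form DGSEM in the element `k`, tested with `φ`;
`Ut` is the time derivative of `U` in that element. -/
def SplitEq (z : Snapshot N K Fi Fb) (g : Gas) (Fec : State → State → BlockVec)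
    (m : Mesh N K Fi Fb) (x : Fin (N + 1) → ℝ) (k : K) (Ut φ : Node N → State) : Prop :=
  ipN x (fun I => m.J k I • Ut I) φ
      + ipN x (m.splitDiv x Fec k (z.U k)) φ
      + surfInt m x k (fun s q =>
          sdot (φ (s.node q)) (z.numF g Fec m (k, s) q - z.Fn g m (k, s) q))
    = 1 / g.reynolds * ipN x (m.stdDiv x k (z.Fv g k)) φ
      + 1 / g.reynolds * surfInt m x k (fun s q =>
          sdot (φ (s.node q)) (z.numFv g m (k, s) q - z.Fvn g m (k, s) q))

/-- Second equation of the split-form DGSEM (for the auxiliary gradient of the entropy variables) in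
the element `k`, tested with the block vector `θ`. -/
def GradEq (z : Snapshot N K Fi Fb) (g : Gas) (m : Mesh N K Fi Fb) (x : Fin (N + 1) → ℝ)
    (k : K) (θ : Node N → BlockVec) : Prop :=
  ∑ I, volWeight x I * ∑ i, sdot (m.J k I • z.Q k I i) (θ I i)
    = surfInt m x k (fun s q =>
        sdot (z.numW g m (k, s) q) (ndot (θ (s.node q)) (m.normal (k, s) q)))
      - ipN x (z.W g k) (m.stdDiv x k θ)

/-- Total discrete entropy `∑_k (J^k S^k, 1)_N`. -/
def totalEntropy [Fintype K] (z : Snapshot N K Fi Fb) (g : Gas) (m : Mesh N K Fi Fb)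
    (x : Fin (N + 1) → ℝ) : ℝ :=
  ∑ k, ∑ I, volWeight x I * (m.J k I * entropy g (z.U k I))

/-- Jump `[[W]] = W_R - W_L` at a point of an interior face. -/
def jumpW (z : Snapshot N K Fi Fb) (g : Gas) (m : Mesh N K Fi Fb) (f : Fi) (q : FaceNode N) :
    State :=
  z.Wtr g (m.right f) ((m.glue f).act q) - z.Wtr g (m.left f) q

/-- Interface dissipation `∑_{interior faces} ∫_N (λ_max / 2) [[W]]ᵀ [[W]] ŝ dS`. -/
def interfaceDissipation [Fintype Fi] (z : Snapshot N K Fi Fb) (g : Gas) (m : Mesh N K Fi Fb)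
    (x : Fin (N + 1) → ℝ) : ℝ :=
  ∑ f, faceInt m x (m.left f) (fun q => z.lam f q / 2 * sdot (z.jumpW g m f q) (z.jumpW g m f q))

/-- Physical boundary terms: those of the continuous entropy estimate,
`- F^S · n + (1/Re) Wᵀ (F^v · n)`, plus the contributions
`- Wᵀ (F*_n - F_n) + (1/Re) ((W* - W)ᵀ F^v_n + Wᵀ (F^{v,*}_n - F^v_n))` of the numerical
boundary fluxes. -/
def boundaryTerms [Fintype Fb] (z : Snapshot N K Fi Fb) (g : Gas) (m : Mesh N K Fi Fb)
    (x : Fin (N + 1) → ℝ) : ℝ :=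
  ∑ b, faceInt m x (m.bdry b) (fun q =>
    - z.entFluxN g m (m.bdry b) q
      + 1 / g.reynolds * sdot (z.Wtr g (m.bdry b) q) (z.Fvn g m (m.bdry b) q)
      - sdot (z.Wtr g (m.bdry b) q) (z.bd.Fstar b q - z.Fn g m (m.bdry b) q)
      + 1 / g.reynolds *
        (sdot (z.bd.Wstar b q - z.Wtr g (m.bdry b) q) (z.Fvn g m (m.bdry b) q)
          + sdot (z.Wtr g (m.bdry b) q) (z.bd.Fvstar b q - z.Fvn g m (m.bdry b) q)))

/-- The physical boundary terms when the advective boundary flux is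
`F*_n = F^ec(U, U_ext) · n - (λ_max / 2) [[W]]` with exterior states `U_ext`, written out. -/
def boundaryTermsExt [Fintype Fb] (z : Snapshot N K Fi Fb) (g : Gas)
    (Fec : State → State → BlockVec) (m : Mesh N K Fi Fb) (x : Fin (N + 1) → ℝ)
    (lamB : Fb → FaceNode N → ℝ) (Uext : Fb → FaceNode N → State) : ℝ :=
  ∑ b, faceInt m x (m.bdry b) (fun q =>
    - z.entFluxN g m (m.bdry b) q
      + 1 / g.reynolds * sdot (z.Wtr g (m.bdry b) q) (z.Fvn g m (m.bdry b) q)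
      - sdot (z.Wtr g (m.bdry b) q)
          (ndot (Fec (z.Utr (m.bdry b) q) (Uext b q)) (m.normal (m.bdry b) q)
            - z.Fn g m (m.bdry b) q)
      + lamB b q / 2 * sdot (z.Wtr g (m.bdry b) q)
          (entropyVars g (Uext b q) - z.Wtr g (m.bdry b) q)
      + 1 / g.reynolds *
        (sdot (z.bd.Wstar b q - z.Wtr g (m.bdry b) q) (z.Fvn g m (m.bdry b) q)
          + sdot (z.Wtr g (m.bdry b) q) (z.bd.Fvstar b q - z.Fvn g m (m.bdry b) q)))

end Snapshot

/-- `z` is a semi-discrete solution on `[0, T]` of the split-form DGSEM: the nodal states have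
positive density and pressure and are differentiable in time, and both equations of the scheme hold
in each element, for all test functions. -/
structure IsSolution (g : Gas) (Fec : State → State → BlockVec) (m : Mesh N K Fi Fb)
    (x : Fin (N + 1) → ℝ) (T : ℝ) (z : ℝ → Snapshot N K Fi Fb) : Prop where
  admissible : ∀ t ∈ Set.Icc 0 T, ∀ k I, Admissible g ((z t).U k I)
  lam_nonneg : ∀ t ∈ Set.Icc 0 T, ∀ f q, 0 ≤ (z t).lam f q
  split_eq : ∀ t ∈ Set.Icc 0 T, ∃ Ut : K → Node N → State,
    (∀ k I, HasDerivWithinAt (fun τ => (z τ).U k I) (Ut k I) (Set.Icc 0 T) t) ∧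
      ∀ k φ, (z t).SplitEq g Fec m x k (Ut k) φ
  grad_eq : ∀ t ∈ Set.Icc 0 T, ∀ k θ, (z t).GradEq g m x k θ

end DGSEM

end

namespace DGSEM

open Polynomial

/-! ### Legendre polynomials -/

/-! The continuous entropy argument is repeated discretely: contract the conservation law with `W`,
the gradient equation with `F^v`, and integrate by parts. Both are legitimate test functions because
arbitrary nodal values define polynomials of degree at most `N` in each direction. Integration by
parts is the summation-by-parts identity `weight_mul_derivMatrix_add`. It is proved entry by entry
from closed forms of the derivative matrix, which follow from Legendre's equation; no exactness of
the quadrature is used. On each grid line, symmetry and Tadmor's condition turn the antisymmetric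
part of the tested two-point flux into a jump of the potential `ψ = wᵀf - f^S` times averaged metric
terms. Summation by parts leaves end-point values and `ψ` times derivatives of the metric terms; the
latter sum to zero over the directions by the metric identities. Hence the Euler volume terms equal
the entropy flux through the element boundary (`ipN_splitDiv_entropyVars`). The viscous volume term
becomes surface terms minus `(JQ, F^v)_N`, which is nonnegative (`sum_sdot_viscFlux_nonneg`). The
two sides of an interior face then cancel up to the jump dissipation
(`faceProduction_left_add_right`), and the boundary faces leave PBT. In time, `w = ∂s/∂u` and the
chain rule identify `(JU_t, W)_N` with the entropy rate. -/

lemma legendre_add_two (k : ℕ) (y : ℝ) :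
    ((k : ℝ) + 2) * (legendre (k + 2)).eval y =
      (2 * k + 3) * y * (legendre (k + 1)).eval y - (k + 1) * (legendre k).eval y := by
  have h : (k : ℝ) + 2 ≠ 0 := by positivity
  rw [legendre]
  simp only [eval_sub, eval_mul, eval_C, eval_X]
  field_simp

lemma derivative_legendre_add_two (k : ℕ) (y : ℝ) :
    ((k : ℝ) + 2) * (derivative (legendre (k + 2))).eval y =
      (2 * k + 3) * ((legendre (k + 1)).eval y + y * (derivative (legendre (k + 1))).eval y)
        - (k + 1) * (derivative (legendre k)).eval y := by
  have h : (k : ℝ) + 2 ≠ 0 := by positivity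
  rw [legendre]
  simp only [derivative_sub, derivative_mul, derivative_C, derivative_X, zero_mul, zero_add,
    mul_one, eval_sub, eval_add, eval_mul, eval_C, eval_X]
  field_simp

/-- The two relations are proved jointly because the first one at `n + 1` needs the second one at
`n`. -/
lemma derivative_legendre_succ_aux (n : ℕ) (y : ℝ) :
    (derivative (legendre (n + 1))).eval y =
        y * (derivative (legendre n)).eval y + (n + 1) * (legendre n).eval y ∧
      y * (derivative (legendre (n + 1))).eval y =
        (derivative (legendre n)).eval y + (n + 1) * (legendre (n + 1)).eval y := by
  induction n with
  | zero => simp [legendre]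
  | succ n ih =>
    obtain ⟨h₁, h₂⟩ := ih
    have e := legendre_add_two n y
    have e' := derivative_legendre_add_two n y
    have h : (n : ℝ) + 2 ≠ 0 := by positivity
    have h₃ : (derivative (legendre (n + 2))).eval y =
        y * (derivative (legendre (n + 1))).eval y + (n + 2) * (legendre (n + 1)).eval y := by
      apply mul_left_cancel₀ h
      rw [e']
      linear_combination ((n : ℝ) + 1) * h₂
    push_cast
    refine ⟨by rw [h₃]; ring, ?_⟩
    show y * (derivative (legendre (n + 2))).eval y = (derivative (legendre (n + 1))).eval y +
      ((n : ℝ) + 1 + 1) * (legendre (n + 2)).eval y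
    linear_combination y * h₃ - e + y * h₂ - h₁

lemma derivative_legendre_succ (n : ℕ) (y : ℝ) :
    (derivative (legendre (n + 1))).eval y =
      y * (derivative (legendre n)).eval y + (n + 1) * (legendre n).eval y :=
  (derivative_legendre_succ_aux n y).1

lemma mul_derivative_legendre_succ (n : ℕ) (y : ℝ) :
    y * (derivative (legendre (n + 1))).eval y =
      (derivative (legendre n)).eval y + (n + 1) * (legendre (n + 1)).eval y :=
  (derivative_legendre_succ_aux n y).2

/-- The polynomial `(x² - 1) L_N'` whose zeros are the Gauss-Lobatto nodes. -/
noncomputable def lobattoPoly (N : ℕ) : ℝ[X] := (X ^ 2 - 1) * derivative (legendre N)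

/-- With the derivative of `L_N` eliminated, Legendre's equation follows by differentiating only
once. -/
lemma lobattoPoly_succ (n : ℕ) :
    lobattoPoly (n + 1) = C ((n : ℝ) + 1) * (X * legendre (n + 1) - legendre n) := by
  refine Polynomial.funext fun y => ?_
  simp only [lobattoPoly, eval_mul, eval_sub, eval_pow, eval_X, eval_one, eval_C]
  linear_combination y * mul_derivative_legendre_succ n y - derivative_legendre_succ n y

/-- Legendre's differential equation. -/
lemma derivative_lobattoPoly (N : ℕ) :
    derivative (lobattoPoly N) = C ((N : ℝ) * (N + 1)) * legendre N := by
  cases N with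
  | zero => simp [lobattoPoly, legendre]
  | succ n =>
    refine Polynomial.funext fun y => ?_
    rw [lobattoPoly_succ]
    simp only [derivative_mul, derivative_C, derivative_sub, derivative_X, zero_mul, zero_add,
      one_mul, eval_mul, eval_sub, eval_add, eval_X, eval_C]
    push_cast
    linear_combination ((n : ℝ) + 1) * mul_derivative_legendre_succ n y

lemma natDegree_legendre_le (n : ℕ) : (legendre n).natDegree ≤ n := by
  induction n using Nat.strong_induction_on with
  | _ n ih =>
    match n, ih with
    | 0, _ => simp [legendre]
    | 1, _ => simp [legendre]
    | k + 2, ih =>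
      rw [legendre]
      have h₁ := ih (k + 1) (by omega)
      have h₀ := ih k (by omega)
      refine (natDegree_sub_le _ _).trans (max_le ?_ ?_)
      · refine natDegree_mul_le.trans ?_
        have : (C ((2 * (k : ℝ) + 3) / ((k : ℝ) + 2)) * X).natDegree ≤ 1 := by compute_degree
        omega
      · exact (natDegree_C_mul_le _ _).trans (by omega)

lemma natDegree_lobattoPoly_le {N : ℕ} (hN : 1 ≤ N) : (lobattoPoly N).natDegree ≤ N + 1 := by
  refine natDegree_mul_le.trans ?_
  have h₁ : (X ^ 2 - 1 : ℝ[X]).natDegree ≤ 2 := by compute_degree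
  have h₂ := natDegree_derivative_le (legendre N)
  have h₃ := natDegree_legendre_le N
  omega

/-- The recurrence reads `(n+2)(L_{n+2} - L_{n+1}) = (2n+3)(y-1) L_{n+1} + (n+1)(L_{n+1} - L_n)`, so
positivity and growth in `n` propagate together. -/
lemma legendre_pos_of_one_le (n : ℕ) {y : ℝ} (hy : 1 ≤ y) :
    0 < (legendre n).eval y ∧ (legendre n).eval y ≤ (legendre (n + 1)).eval y := by
  induction n with
  | zero => simpa [legendre] using hy
  | succ n ih =>
    have h : (0 : ℝ) < n + 2 := by positivity
    have e := legendre_add_two n y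
    have hp : 0 < (legendre (n + 1)).eval y := ih.1.trans_le ih.2
    refine ⟨hp, le_of_mul_le_mul_left ?_ h⟩
    show ((n : ℝ) + 2) * _ ≤ (n + 2) * (legendre (n + 2)).eval y
    rw [e]
    have h₁ : 0 ≤ (2 * (n : ℝ) + 3) * (y - 1) * (legendre (n + 1)).eval y := by
      have : 0 ≤ y - 1 := by linarith
      positivity
    have h₂ : 0 ≤ ((n : ℝ) + 1) * ((legendre (n + 1)).eval y - (legendre n).eval y) := by
      have := sub_nonneg.2 ih.2
      positivity
    nlinarith [h₁, h₂]

lemma derivative_legendre_succ_pos (n : ℕ) {y : ℝ} (hy : 1 ≤ y) :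
    0 < (derivative (legendre (n + 1))).eval y := by
  induction n with
  | zero => simp [legendre]
  | succ n ih =>
    rw [derivative_legendre_succ]
    have h := (legendre_pos_of_one_le (n + 1) hy).1
    positivity

lemma legendre_neg_aux (n : ℕ) (y : ℝ) :
    (legendre n).eval (-y) = (-1) ^ n * (legendre n).eval y ∧
      (legendre (n + 1)).eval (-y) = (-1) ^ (n + 1) * (legendre (n + 1)).eval y := by
  induction n with
  | zero => simp [legendre]
  | succ n ih =>
    refine ⟨ih.2, ?_⟩
    have h : (n : ℝ) + 2 ≠ 0 := by positivity
    apply mul_left_cancel₀ h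
    have e := legendre_add_two n y
    have e' := legendre_add_two n (-y)
    rw [ih.1, ih.2] at e'
    show ((n : ℝ) + 2) * (legendre (n + 2)).eval (-y) =
      (n + 2) * ((-1) ^ (n + 2) * (legendre (n + 2)).eval y)
    linear_combination e' - (-1) ^ n * e

lemma legendre_neg (n : ℕ) (y : ℝ) :
    (legendre n).eval (-y) = (-1) ^ n * (legendre n).eval y :=
  (legendre_neg_aux n y).1

lemma derivative_legendre_neg (n : ℕ) (y : ℝ) :
    (derivative (legendre n)).eval (-y) =
      (-1) ^ (n + 1) * (derivative (legendre n)).eval y := by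
  induction n with
  | zero => simp [legendre]
  | succ n ih =>
    rw [derivative_legendre_succ, derivative_legendre_succ, ih, legendre_neg]
    ring

lemma legendre_sq_neg (n : ℕ) (y : ℝ) :
    (legendre n).eval (-y) ^ 2 = (legendre n).eval y ^ 2 := by
  rw [legendre_neg, mul_pow, ← pow_mul, mul_comm n 2, pow_mul]
  simp

lemma legendre_one_aux (n : ℕ) :
    (legendre n).eval 1 = 1 ∧ (legendre (n + 1)).eval 1 = 1 := by
  induction n with
  | zero => simp [legendre]
  | succ n ih =>
    refine ⟨ih.2, ?_⟩
    have h : (n : ℝ) + 2 ≠ 0 := by positivity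
    apply mul_left_cancel₀ h
    have e := legendre_add_two n 1
    rw [ih.1, ih.2] at e
    show ((n : ℝ) + 2) * (legendre (n + 2)).eval 1 = (n + 2) * 1
    linear_combination e

lemma legendre_one (n : ℕ) : (legendre n).eval 1 = 1 := (legendre_one_aux n).1

/-! ### Gauss-Lobatto nodes and the summation-by-parts property -/

variable {N : ℕ} {x : Fin (N + 1) → ℝ}

lemma weight_nonneg (x : Fin (N + 1) → ℝ) (j : Fin (N + 1)) : 0 ≤ weight x j := by
  unfold weight
  positivity

/-- `L_N'` is positive on `[1, ∞)`, and parity carries this to `(-∞, -1]` up to sign. This makes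
`±1` the extreme nodes. -/
lemma abs_lt_one_of_derivative_legendre_eq_zero (hN : 1 ≤ N) {y : ℝ}
    (hy : (derivative (legendre N)).eval y = 0) : -1 < y ∧ y < 1 := by
  obtain ⟨n, rfl⟩ : ∃ n, N = n + 1 := ⟨N - 1, by omega⟩
  constructor
  · by_contra! h
    have h₁ := derivative_legendre_succ_pos n (y := -y) (by linarith)
    rw [derivative_legendre_neg, hy, mul_zero] at h₁
    exact h₁.false
  · by_contra! h
    exact (derivative_legendre_succ_pos n h).ne' hy

namespace IsGaussLobatto

lemma mem_Icc (hx : IsGaussLobatto N x) (hN : 1 ≤ N) (j : Fin (N + 1)) : -1 ≤ x j ∧ x j ≤ 1 := by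
  rcases (hx.range_iff (x j)).1 ⟨j, rfl⟩ with h | h | h
  · rw [h]; norm_num
  · rw [h]; norm_num
  · have := abs_lt_one_of_derivative_legendre_eq_zero hN h
    exact ⟨this.1.le, this.2.le⟩

lemma zero_eq (hx : IsGaussLobatto N x) (hN : 1 ≤ N) : x 0 = -1 := by
  obtain ⟨j, hj⟩ := (hx.range_iff (-1)).2 (Or.inl rfl)
  exact le_antisymm (hj ▸ hx.strictMono.monotone (Fin.zero_le j)) (hx.mem_Icc hN 0).1

lemma last_eq (hx : IsGaussLobatto N x) (hN : 1 ≤ N) : x (Fin.last N) = 1 := by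
  obtain ⟨j, hj⟩ := (hx.range_iff 1).2 (Or.inr (Or.inl rfl))
  exact le_antisymm (hx.mem_Icc hN _).2 (hj ▸ hx.strictMono.monotone (Fin.le_last j))

/-- The node set is invariant under negation, and a finite set has only one increasing enumeration.
-/
lemma rev_eq_neg (hx : IsGaussLobatto N x) (j : Fin (N + 1)) : x j.rev = -x j := by
  have hmono : StrictMono fun j : Fin (N + 1) => -x j.rev := fun a b h =>
    neg_lt_neg (hx.strictMono (Fin.rev_lt_rev.2 h))
  have hr : Set.range (fun j : Fin (N + 1) => -x j.rev) = Set.range x := by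
    have key : ∀ y, (∃ j, x j = y) → ∃ j, x j = -y := fun y hy => by
      rw [hx.range_iff] at hy ⊢
      rcases hy with rfl | rfl | h
      · simp
      · simp
      · right; right; rw [derivative_legendre_neg, h, mul_zero]
    ext y
    constructor
    · rintro ⟨j, rfl⟩
      exact key _ ⟨_, rfl⟩
    · rintro ⟨j, rfl⟩
      obtain ⟨i, hi⟩ := key _ ⟨j, rfl⟩
      exact ⟨i.rev, by simp [hi]⟩
  have := congrFun ((hmono.range_inj hx.strictMono).1 hr) j
  linarith

lemma weight_rev (hx : IsGaussLobatto N x) (j : Fin (N + 1)) : weight x j.rev = weight x j := by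
  unfold weight
  rw [hx.rev_eq_neg, legendre_sq_neg]

/-- The `N + 1` distinct nodes are roots of a nonzero polynomial of degree at most `N + 1`, so the
cofactor is constant. In particular all its roots are simple. -/
lemma exists_lobattoPoly_eq (hx : IsGaussLobatto N x) (hN : 1 ≤ N) :
    ∃ c : ℝ, c ≠ 0 ∧ lobattoPoly N = C c * Lagrange.nodal Finset.univ x := by
  have hne : lobattoPoly N ≠ 0 := by
    obtain ⟨n, rfl⟩ : ∃ n, N = n + 1 := ⟨N - 1, by omega⟩
    intro h
    have h₁ := congrArg (eval 2) h
    have h₂ := derivative_legendre_succ_pos n (y := 2) (by norm_num)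
    simp only [lobattoPoly, eval_mul, eval_sub, eval_pow, eval_X, eval_one, eval_zero] at h₁
    linarith
  have hdvd : Lagrange.nodal Finset.univ x ∣ lobattoPoly N := by
    rw [Lagrange.nodal]
    refine Finset.prod_dvd_of_coprime ?_ ?_
    · intro i _ j _ hij
      exact Polynomial.pairwise_coprime_X_sub_C hx.strictMono.injective hij
    · intro i _
      rw [dvd_iff_isRoot, IsRoot.def, lobattoPoly, eval_mul]
      rcases (hx.range_iff (x i)).1 ⟨i, rfl⟩ with h | h | h
      · simp [h]
      · simp [h]
      · rw [h, mul_zero]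
  obtain ⟨r, hr⟩ := hdvd
  have hr0 : r ≠ 0 := by rintro rfl; exact hne (by rw [hr, mul_zero])
  have hdeg : r.natDegree = 0 := by
    have h₁ := natDegree_lobattoPoly_le hN
    rw [hr, natDegree_mul Lagrange.nodal_ne_zero hr0, Lagrange.natDegree_nodal] at h₁
    simp at h₁
    exact h₁
  obtain ⟨c, rfl⟩ := natDegree_eq_zero.1 hdeg
  exact ⟨c, by simpa using hr0, by rw [hr, mul_comm]⟩

/-- By Legendre's equation `L_N` is a multiple of the derivative of the nodal polynomial, which does
not vanish at a simple root. Thus no weight divides by zero. -/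
lemma legendre_ne_zero (hx : IsGaussLobatto N x) (hN : 1 ≤ N) (j : Fin (N + 1)) :
    (legendre N).eval (x j) ≠ 0 := by
  obtain ⟨c, hc, h⟩ := hx.exists_lobattoPoly_eq hN
  have h₁ := congrArg (fun p => (derivative p).eval (x j)) h
  simp only [derivative_lobattoPoly, derivative_C_mul, eval_mul, eval_C] at h₁
  intro h₀
  rw [h₀, mul_zero, Lagrange.eval_nodal_derivative_eval_node_eq (Finset.mem_univ j),
    Lagrange.eval_nodal] at h₁
  refine mul_ne_zero hc (Finset.prod_ne_zero_iff.2 fun i hi => ?_) h₁.symm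
  exact sub_ne_zero.2 fun e => (Finset.mem_erase.1 hi).1 (hx.strictMono.injective e).symm

/-- The Lagrange polynomials in terms of the Lobatto polynomial. -/
lemma basis_mul (hx : IsGaussLobatto N x) (hN : 1 ≤ N) (n : Fin (N + 1)) :
    C ((N : ℝ) * (N + 1) * (legendre N).eval (x n)) *
        (Lagrange.basis Finset.univ x n * (X - C (x n))) = lobattoPoly N := by
  obtain ⟨c, hc, h⟩ := hx.exists_lobattoPoly_eq hN
  have h₁ := congrArg (fun p => (derivative p).eval (x n)) h
  simp only [derivative_lobattoPoly, derivative_C_mul, eval_mul, eval_C] at h₁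
  have hw : Lagrange.nodalWeight Finset.univ x n ≠ 0 :=
    Lagrange.nodalWeight_ne_zero hx.strictMono.injective.injOn (Finset.mem_univ n)
  have h₂ := Lagrange.nodalWeight_eq_eval_derivative_nodal (v := x) (Finset.mem_univ n)
  have h₃ : (derivative (Lagrange.nodal Finset.univ x)).eval (x n) =
      (Lagrange.nodalWeight Finset.univ x n)⁻¹ := by rw [h₂, inv_inv]
  rw [h₁, h, h₃, Lagrange.basis_eq_prod_sub_inv_mul_nodal_div (Finset.mem_univ n),
    ← Lagrange.nodal_erase_eq_nodal_div (Finset.mem_univ n),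
    Lagrange.nodal_eq_mul_nodal_erase (v := x) (Finset.mem_univ n)]
  have h₄ : C (Lagrange.nodalWeight Finset.univ x n)⁻¹ * C (Lagrange.nodalWeight Finset.univ x n)
      = (1 : ℝ[X]) := by rw [← C_mul, inv_mul_cancel₀ hw, C_1]
  rw [C_mul]
  linear_combination C c * (X - C (x n)) * Lagrange.nodal (Finset.univ.erase n) x * h₄

/-- Off-diagonal entries of the derivative matrix. -/
lemma derivMatrix_mul (hx : IsGaussLobatto N x) (hN : 1 ≤ N) (j n : Fin (N + 1)) (h : j ≠ n) :
    derivMatrix x j n * (legendre N).eval (x n) * (x j - x n) = (legendre N).eval (x j) := by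
  have hN' : (N : ℝ) * (N + 1) ≠ 0 := by positivity
  -- Differentiating once at `x j` removes the undifferentiated factor, since `ℓ_n(x_j) = 0`.
  have h₁ := congrArg (fun p => (derivative p).eval (x j)) (hx.basis_mul hN n)
  have h₂ := Lagrange.eval_basis_of_ne (v := x) h.symm (Finset.mem_univ j)
  simp only [derivative_lobattoPoly, eval_mul, eval_C, derivative_mul, eval_add,
    derivative_sub, derivative_X, derivative_C, sub_zero, mul_one, eval_sub, eval_X,
    zero_mul, zero_add, h₂, add_zero] at h₁
  apply mul_left_cancel₀ hN'
  rw [← h₁, derivMatrix]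
  ring

/-- Diagonal entries of the derivative matrix. -/
lemma derivMatrix_self (hx : IsGaussLobatto N x) (hN : 1 ≤ N) (n : Fin (N + 1)) :
    2 * derivMatrix x n n * (legendre N).eval (x n) = (derivative (legendre N)).eval (x n) := by
  have hN' : (N : ℝ) * (N + 1) ≠ 0 := by positivity
  -- At `x n` the second derivative of `ℓ_n (X - x_n)` is `2 ℓ_n'`, the source of the factor 2.
  have h₁ := congrArg (fun p => (derivative (derivative p)).eval (x n)) (hx.basis_mul hN n)
  simp only [derivative_lobattoPoly, eval_mul, eval_C, derivative_mul, eval_add,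
    derivative_sub, derivative_X, derivative_C, sub_zero, mul_one, eval_sub, eval_X,
    zero_mul, sub_self, mul_zero, derivative_add, zero_add] at h₁
  apply mul_left_cancel₀ hN'
  rw [← h₁, derivMatrix]
  ring

lemma weight_mul_derivMatrix_self_of_sq_eq_one (hx : IsGaussLobatto N x) (hN : 1 ≤ N)
    (n : Fin (N + 1)) (hn : x n = 1 ∨ x n = -1) :
    weight x n * derivMatrix x n n + weight x n * derivMatrix x n n = x n := by
  have hNpos : (0 : ℝ) < N := by exact_mod_cast hN
  have hL := hx.legendre_ne_zero hN n
  have h₁ := hx.derivMatrix_self hN n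
  have hsq : x n ^ 2 = 1 := by rcases hn with h | h <;> rw [h] <;> norm_num
  have hL2 : (legendre N).eval (x n) ^ 2 = 1 := by
    rcases hn with h | h <;> rw [h]
    · rw [legendre_one, one_pow]
    · rw [legendre_sq_neg, legendre_one, one_pow]
  have h₂ : 2 * x n * (derivative (legendre N)).eval (x n) =
      N * (N + 1) * (legendre N).eval (x n) := by
    have h := congrArg (eval (x n)) (derivative_lobattoPoly N)
    simp only [lobattoPoly, derivative_mul, derivative_sub, derivative_X_pow, derivative_one,
      sub_zero, eval_add, eval_mul, eval_sub, eval_pow, eval_X, eval_one, eval_C, hsq, sub_self,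
      zero_mul, add_zero, pow_one, Nat.cast_ofNat, Nat.add_one_sub_one] at h
    exact h
  -- Legendre's equation at `±1` gives `L_N'`, hence the corner entry `±N(N+1)/4`; the weight there
  -- is `2/(N(N+1))`.
  have h₃ : 4 * x n * derivMatrix x n n = N * (N + 1) := by
    apply mul_right_cancel₀ hL
    linear_combination 2 * x n * h₁ + h₂
  unfold weight
  rw [hL2]
  field_simp
  linear_combination x n * h₃ - 4 * derivMatrix x n n * hsq

/-- Summation by parts: `w_j D_{jn} + w_n D_{nj} = δ_{jn} (δ_{jN} - δ_{j0})`. -/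
lemma weight_mul_derivMatrix_add (hx : IsGaussLobatto N x) (hN : 1 ≤ N) (j n : Fin (N + 1)) :
    weight x j * derivMatrix x j n + weight x n * derivMatrix x n j =
      if j = n then ((if j = Fin.last N then 1 else 0) - if j = 0 then 1 else 0) else 0 := by
  have hNpos : (0 : ℝ) < N := by exact_mod_cast hN
  have hL := hx.legendre_ne_zero hN
  by_cases hjn : j = n
  · subst hjn
    rw [if_pos rfl]
    have hne : (0 : Fin (N + 1)) ≠ Fin.last N := by
      intro h
      have := congrArg Fin.val h
      simp at this
      omega
    by_cases h₁ : j = Fin.last N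
    · subst h₁
      rw [hx.weight_mul_derivMatrix_self_of_sq_eq_one hN _ (Or.inl (hx.last_eq hN)),
        hx.last_eq hN, if_pos rfl, if_neg hne.symm, sub_zero]
    · by_cases h₂ : j = 0
      · subst h₂
        rw [hx.weight_mul_derivMatrix_self_of_sq_eq_one hN _ (Or.inr (hx.zero_eq hN)),
          hx.zero_eq hN, if_pos rfl, if_neg hne, zero_sub]
      · rw [if_neg h₁, if_neg h₂, sub_zero]
        have hD : derivMatrix x j j = 0 := by
          have h := hx.derivMatrix_self hN j
          rcases (hx.range_iff (x j)).1 ⟨j, rfl⟩ with e | e | e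
          · exact absurd (hx.strictMono.injective (e.trans (hx.zero_eq hN).symm)) h₂
          · exact absurd (hx.strictMono.injective (e.trans (hx.last_eq hN).symm)) h₁
          · rw [e] at h
            simpa [hL j] using h
        rw [hD]
        ring
  · rw [if_neg hjn]
    have h₁ := hx.derivMatrix_mul hN j n hjn
    have h₂ := hx.derivMatrix_mul hN n j (Ne.symm hjn)
    have hne : x j - x n ≠ 0 := sub_ne_zero.2 fun e => hjn (hx.strictMono.injective e)
    have hj := hL j
    have hn := hL n
    -- Off the diagonal, `w_j D_{jn}` is a constant times `1 / (L_N(x_j) L_N(x_n) (x_j - x_n))`,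
    -- which is antisymmetric.
    have key : derivMatrix x j n * (legendre N).eval (x n) ^ 2 +
        derivMatrix x n j * (legendre N).eval (x j) ^ 2 = 0 := by
      apply mul_right_cancel₀ hne
      linear_combination (legendre N).eval (x n) * h₁ - (legendre N).eval (x j) * h₂
    unfold weight
    field_simp
    linear_combination 2 * key

/-- The Lagrange polynomials sum to 1, so constants have zero derivative. -/
lemma sum_derivMatrix (hx : IsGaussLobatto N x) (j : Fin (N + 1)) : ∑ n, derivMatrix x j n = 0 := by
  have h := Lagrange.sum_basis (s := Finset.univ) (v := x) hx.strictMono.injective.injOn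
    Finset.univ_nonempty
  have := congrArg (fun p => (derivative p).eval (x j)) h
  simpa [derivative_sum, eval_finsetSum, derivMatrix] using this

end IsGaussLobatto

variable {K Fi Fb : Type*}

/-! ### Entropy conservation of the split form along a line -/

namespace IsGaussLobatto

lemma sum_weight_mul_derivMatrix_add (hx : IsGaussLobatto N x) (hN : 1 ≤ N)
    (p : Fin (N + 1) → Fin (N + 1) → ℝ) :
    ∑ i, ∑ j, weight x i * derivMatrix x i j * p i j
        + ∑ i, ∑ j, weight x i * derivMatrix x i j * p j i
      = p (Fin.last N) (Fin.last N) - p 0 0 := by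
  rw [Finset.sum_comm (f := fun i j => weight x i * derivMatrix x i j * p j i),
    ← Finset.sum_add_distrib]
  simp_rw [← Finset.sum_add_distrib, ← add_mul, hx.weight_mul_derivMatrix_add hN]
  simp [sub_mul]

/-- Of the four products, `ψ i * a i` vanishes by the zero row sums, `ψ j * a j` is then a pure
boundary term, and `ψ j * a i` is exchanged for `ψ i * a j` by summation by parts. -/
lemma sum_weight_mul_derivMatrix_avg (hx : IsGaussLobatto N x) (hN : 1 ≤ N)
    (ψ a : Fin (N + 1) → ℝ) :
    ∑ i, ∑ j, weight x i * derivMatrix x i j * ((ψ i - ψ j) * ((a i + a j) / 2))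
      = ∑ i, ∑ j, weight x i * derivMatrix x i j * (ψ i * a j)
        - (ψ (Fin.last N) * a (Fin.last N) - ψ 0 * a 0) := by
  have h₁ := hx.sum_weight_mul_derivMatrix_add hN fun i j => ψ i * a j
  have h₂ := hx.sum_weight_mul_derivMatrix_add hN fun i _ => ψ i * a i
  have h₃ : ∑ i, ∑ j, weight x i * derivMatrix x i j * (ψ i * a i) = 0 := by
    refine Finset.sum_eq_zero fun i _ => ?_
    rw [← Finset.sum_mul, ← Finset.mul_sum, hx.sum_derivMatrix, mul_zero, zero_mul]
  have h₄ : ∑ i, ∑ j, weight x i * derivMatrix x i j * ((ψ i - ψ j) * ((a i + a j) / 2)) =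
      (∑ i, ∑ j, weight x i * derivMatrix x i j * (ψ i * a i)
        + ∑ i, ∑ j, weight x i * derivMatrix x i j * (ψ i * a j)
        - ∑ i, ∑ j, weight x i * derivMatrix x i j * (ψ j * a i)
        - ∑ i, ∑ j, weight x i * derivMatrix x i j * (ψ j * a j)) / 2 := by
    simp_rw [← Finset.sum_add_distrib, ← Finset.sum_sub_distrib, Finset.sum_div]
    refine Finset.sum_congr rfl fun i _ => Finset.sum_congr rfl fun j _ => ?_
    ring
  rw [h₄]
  linarith

/-- Flux differencing on a line with a two-point quantity `p` whose antisymmetric part is a jump of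
potentials `ψ` times averaged metric terms `a`. -/
lemma sum_flux_differencing (hx : IsGaussLobatto N x) (hN : 1 ≤ N)
    {p : Fin (N + 1) → Fin (N + 1) → ℝ} {ψ a : Fin (N + 1) → Fin 3 → ℝ}
    (h : ∀ i j, p i j - p j i = ∑ n, (ψ i n - ψ j n) * ((a i n + a j n) / 2)) :
    ∑ i, weight x i * (2 * ∑ j, derivMatrix x i j * p i j)
      = ∑ i, weight x i * ∑ n, ψ i n * ∑ j, derivMatrix x i j * a j n
        + (p (Fin.last N) (Fin.last N) - ∑ n, ψ (Fin.last N) n * a (Fin.last N) n)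
        - (p 0 0 - ∑ n, ψ 0 n * a 0 n) := by
  -- Twice the sum with `p i j` splits into a symmetric part, which is a boundary term, and an
  -- antisymmetric part, which the hypothesis on `p` evaluates.
  have h₁ := hx.sum_weight_mul_derivMatrix_add hN p
  have h₂ : ∑ i, ∑ j, weight x i * derivMatrix x i j * p i j
      - ∑ i, ∑ j, weight x i * derivMatrix x i j * p j i
      = ∑ n, ∑ i, ∑ j, weight x i * derivMatrix x i j *
          ((ψ i n - ψ j n) * ((a i n + a j n) / 2)) := by
    conv_rhs => rw [Finset.sum_comm]
    rw [← Finset.sum_sub_distrib]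
    refine Finset.sum_congr rfl fun i _ => ?_
    conv_rhs => rw [Finset.sum_comm]
    rw [← Finset.sum_sub_distrib]
    refine Finset.sum_congr rfl fun j _ => ?_
    rw [← mul_sub, h, Finset.mul_sum]
  simp_rw [hx.sum_weight_mul_derivMatrix_avg hN, Finset.sum_sub_distrib] at h₂
  have h₃ : ∑ i, weight x i * (2 * ∑ j, derivMatrix x i j * p i j) =
      2 * ∑ i, ∑ j, weight x i * derivMatrix x i j * p i j := by
    simp_rw [Finset.mul_sum]
    refine Finset.sum_congr rfl fun i _ => Finset.sum_congr rfl fun j _ => ?_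
    ring
  have h₄ : ∑ i, weight x i * ∑ n, ψ i n * ∑ j, derivMatrix x i j * a j n =
      ∑ n, ∑ i, ∑ j, weight x i * derivMatrix x i j * (ψ i n * a j n) := by
    rw [Finset.sum_comm]
    simp_rw [Finset.mul_sum]
    refine Finset.sum_congr rfl fun i _ => Finset.sum_congr rfl fun n _ =>
      Finset.sum_congr rfl fun j _ => ?_
    ring
  rw [h₃, h₄]
  linarith

end IsGaussLobatto

/-! ### Algebra of states -/

lemma sdot_sub_left (a b c : State) : sdot (a - b) c = sdot a c - sdot b c := by
  simp [sdot, sub_mul, Finset.sum_sub_distrib]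

lemma sdot_add_left (a b c : State) : sdot (a + b) c = sdot a c + sdot b c := by
  simp [sdot, add_mul, Finset.sum_add_distrib]

lemma sdot_smul_left (r : ℝ) (a b : State) : sdot (r • a) b = r * sdot a b := by
  simp [sdot, Finset.mul_sum, mul_assoc]

lemma sdot_comm (a b : State) : sdot a b = sdot b a := by
  simp [sdot, mul_comm]

lemma sdot_sub_right (a b c : State) : sdot a (b - c) = sdot a b - sdot a c := by
  rw [sdot_comm, sdot_sub_left, sdot_comm b, sdot_comm c]

lemma sdot_add_right (a b c : State) : sdot a (b + c) = sdot a b + sdot a c := by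
  rw [sdot_comm, sdot_add_left, sdot_comm b, sdot_comm c]

lemma sdot_smul_right (r : ℝ) (a b : State) : sdot a (r • b) = r * sdot a b := by
  rw [sdot_comm, sdot_smul_left, sdot_comm b]

lemma sdot_neg_right (a b : State) : sdot a (-b) = -sdot a b := by
  simp [sdot]

lemma sdot_self_nonneg (a : State) : 0 ≤ sdot a a :=
  Finset.sum_nonneg fun _ _ => mul_self_nonneg _

lemma sdot_ndot (a : State) (F : BlockVec) (n : Fin 3 → ℝ) :
    sdot a (ndot F n) = ∑ i, n i * sdot a (F i) := by
  simp only [sdot, ndot, Finset.mul_sum]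
  rw [Finset.sum_comm]
  refine Finset.sum_congr rfl fun i _ => Finset.sum_congr rfl fun c _ => ?_
  ring

lemma ndot_neg (F : BlockVec) (n : Fin 3 → ℝ) : ndot F (-n) = -ndot F n := by
  ext c
  simp [ndot]

/-- Entropy flux potential `wᵀ f - f^S`. -/
noncomputable def entropyPotential (g : Gas) (u : State) (i : Fin 3) : ℝ :=
  sdot (entropyVars g u) (advFlux g u i) - entropyFlux g u i

/-! ### Sums over nodes and faces -/

lemma volWeight_insertNth (x : Fin (N + 1) → ℝ) (d : Fin 3) (i : Fin (N + 1)) (q : FaceNode N) :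
    volWeight x (d.insertNth (α := fun _ => Fin (N + 1)) i q) = surfWeight x q * weight x i := by
  rw [volWeight, surfWeight, Fin.prod_univ_succAbove _ d, mul_comm]
  simp

/-- Slices the cube into lines in direction `d`, indexed by the face nodes at which they end. -/
lemma sum_node_eq (d : Fin 3) (f : Node N → ℝ) :
    ∑ I, f I = ∑ q : FaceNode N, ∑ i, f (d.insertNth (α := fun _ => Fin (N + 1)) i q) := by
  rw [← (Fin.insertNthEquiv (fun _ => Fin (N + 1)) d).sum_comp, Fintype.sum_prod_type,
    Finset.sum_comm]
  rfl

lemma sum_localFace (f : LocalFace → ℝ) : ∑ φ, f φ = ∑ d, (f ⟨d, true⟩ + f ⟨d, false⟩) := by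
  let e : Fin 3 × Bool ≃ LocalFace :=
    ⟨fun p => ⟨p.1, p.2⟩, fun φ => (φ.dir, φ.upper), fun _ => rfl, fun _ => rfl⟩
  rw [← e.sum_comp, Fintype.sum_prod_type]
  refine Finset.sum_congr rfl fun d _ => ?_
  rw [Fintype.sum_bool]
  rfl

lemma volWeight_nonneg (x : Fin (N + 1) → ℝ) (I : Node N) : 0 ≤ volWeight x I :=
  Finset.prod_nonneg fun _ _ => weight_nonneg x _

lemma surfWeight_nonneg (x : Fin (N + 1) → ℝ) (q : FaceNode N) : 0 ≤ surfWeight x q :=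
  Finset.prod_nonneg fun _ _ => weight_nonneg x _

lemma Mesh.surfElem_nonneg (m : Mesh N K Fi Fb) (kf : K × LocalFace) (q : FaceNode N) :
    0 ≤ m.surfElem kf q := Real.sqrt_nonneg _

lemma Mesh.normal_mul_surfElem (m : Mesh N K Fi Fb) (kf : K × LocalFace) (q : FaceNode N)
    (n : Fin 3) :
    m.normal kf q n * m.surfElem kf q = kf.2.sign * m.Ja kf.1 (kf.2.node q) kf.2.dir n := by
  unfold Mesh.normal
  -- If `ŝ = 0`, the quotient defining the normal takes the default value 0, but then `J a^d`
  -- vanishes as well.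
  by_cases h : m.surfElem kf q = 0
  · have h₁ : ∑ n, m.Ja kf.1 (kf.2.node q) kf.2.dir n ^ 2 = 0 :=
      (Real.sqrt_eq_zero (Finset.sum_nonneg fun _ _ => sq_nonneg _)).1 h
    have h₂ := (Finset.sum_eq_zero_iff_of_nonneg fun _ _ => sq_nonneg _).1 h₁ n (Finset.mem_univ n)
    rw [h, mul_zero, pow_eq_zero_iff (two_ne_zero) |>.1 h₂, mul_zero]
  · rw [div_mul_cancel₀ _ h]

/-! ### Entropy conservation of the split form in an element -/

lemma ipN_splitDiv (m : Mesh N K Fi Fb) (x : Fin (N + 1) → ℝ) (Fec : State → State → BlockVec)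
    (k : K) (U W : Node N → State) :
    ipN x (m.splitDiv x Fec k U) W =
      ∑ d, ∑ I, volWeight x I * (2 * ∑ j, derivMatrix x (I d) j *
        ∑ n, sdot (W I) (Fec (U I) (U (Function.update I d j)) n) *
          ((m.Ja k I d n + m.Ja k (Function.update I d j) d n) / 2)) := by
  rw [Finset.sum_comm]
  unfold ipN
  refine Finset.sum_congr rfl fun I _ => ?_
  rw [← Finset.mul_sum]
  congr 1
  simp only [sdot, Mesh.splitDiv, Finset.sum_mul, Finset.mul_sum]
  rw [Finset.sum_comm]
  refine Finset.sum_congr rfl fun d _ => ?_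
  rw [Finset.sum_comm]
  refine Finset.sum_congr rfl fun j _ => ?_
  rw [Finset.sum_comm]
  refine Finset.sum_congr rfl fun n _ => Finset.sum_congr rfl fun c _ => ?_
  ring

/-- The split-form volume terms, tested with the entropy variables, reduce to the entropy flux
through the boundary of the element. -/
lemma ipN_splitDiv_entropyVars (hx : IsGaussLobatto N x) (hN : 1 ≤ N) {g : Gas}
    {Fec : State → State → BlockVec} (hFec : IsEntropyConservative g Fec)
    (m : Mesh N K Fi Fb) (hmetric : m.MetricIdentities x) (z : Snapshot N K Fi Fb)
    (hz : ∀ k I, Admissible g (z.U k I)) (k : K) :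
    ipN x (m.splitDiv x Fec k (z.U k)) (z.W g k) =
      surfInt m x k (fun s q => z.entFluxN g m (k, s) q) := by
  have hline : ∀ d, ∑ I, volWeight x I * (2 * ∑ j, derivMatrix x (I d) j *
        ∑ n, sdot (z.W g k I) (Fec (z.U k I) (z.U k (Function.update I d j)) n) *
          ((m.Ja k I d n + m.Ja k (Function.update I d j) d n) / 2)) =
      ∑ I, volWeight x I * ∑ n, entropyPotential g (z.U k I) n *
          pderiv x d (fun I' => m.Ja k I' d n) I
        + (faceInt m x (k, ⟨d, true⟩) (z.entFluxN g m (k, ⟨d, true⟩))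
          + faceInt m x (k, ⟨d, false⟩) (z.entFluxN g m (k, ⟨d, false⟩))) := by
    intro d
    rw [sum_node_eq d, sum_node_eq d, faceInt, faceInt, ← Finset.sum_add_distrib,
      ← Finset.sum_add_distrib]
    refine Finset.sum_congr rfl fun q _ => ?_
    have hflux : ∀ s : LocalFace, z.entFluxN g m (k, s) q * m.surfElem (k, s) q =
        s.sign * ∑ n, entropyFlux g (z.U k (s.node q)) n * m.Ja k (s.node q) s.dir n := by
      intro s
      rw [Snapshot.entFluxN, Finset.sum_mul, Finset.mul_sum]
      refine Finset.sum_congr rfl fun n _ => ?_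
      rw [mul_assoc, m.normal_mul_surfElem, Snapshot.Utr]
      ring
    -- At a line end, consistency reduces `wᵀF^ec - ψ` to the entropy flux `f^S`.
    have hdiag : ∀ I : Node N, ∑ n, sdot (z.W g k I) (Fec (z.U k I) (z.U k I) n) *
          ((m.Ja k I d n + m.Ja k I d n) / 2)
        - ∑ n, entropyPotential g (z.U k I) n * m.Ja k I d n =
        ∑ n, entropyFlux g (z.U k I) n * m.Ja k I d n := by
      intro I
      rw [← Finset.sum_sub_distrib]
      refine Finset.sum_congr rfl fun n _ => ?_
      rw [hFec.consistent _ (hz k I), entropyPotential, Snapshot.W]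
      ring
    set ι : Fin (N + 1) → Node N := fun i => d.insertNth (α := fun _ => Fin (N + 1)) i q with hι
    have key := hx.sum_flux_differencing hN
      (p := fun i j => ∑ n, sdot (z.W g k (ι i)) (Fec (z.U k (ι i)) (z.U k (ι j)) n) *
          ((m.Ja k (ι i) d n + m.Ja k (ι j) d n) / 2))
      (ψ := fun i => entropyPotential g (z.U k (ι i))) (a := fun i => m.Ja k (ι i) d)
      (by
        intro i j
        rw [← Finset.sum_sub_distrib]
        refine Finset.sum_congr rfl fun n _ => ?_
        -- Symmetry makes both terms contain the same flux, so their difference is `(w_i - w_j)ᵀ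
        -- F^ec` and Tadmor's condition applies.
        rw [hFec.symm _ _ (hz k (ι i)) (hz k (ι j))]
        have ht := hFec.tadmor _ _ (hz k (ι j)) (hz k (ι i)) n
        rw [sdot_sub_left] at ht
        simp only [Snapshot.W, entropyPotential]
        linear_combination ((m.Ja k (ι i) d n + m.Ja k (ι j) d n) / 2) * ht)
    have hup : ∀ i j, Function.update (ι i) d j = ι j := fun i j => by
      simp only [hι, Fin.update_insertNth]
    have hd : ∀ i, ι i d = i := fun i => by simp [hι]
    have h₁ := hflux ⟨d, true⟩
    have h₂ := hflux ⟨d, false⟩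
    have n₁ : (⟨d, true⟩ : LocalFace).node q = ι (Fin.last N) := by simp [LocalFace.node, hι]
    have n₂ : (⟨d, false⟩ : LocalFace).node q = ι 0 := by simp [LocalFace.node, hι]
    rw [n₁] at h₁
    rw [n₂] at h₂
    simp only [LocalFace.sign, if_true, one_mul, Bool.false_eq_true, if_false] at h₁ h₂
    rw [mul_assoc, h₁, mul_assoc, h₂, ← hdiag, ← hdiag]
    have hv : ∀ i, volWeight x (ι i) = surfWeight x q * weight x i :=
      fun i => volWeight_insertNth x d i q
    simp only [pderiv]
    show ∑ i, volWeight x (ι i) * (2 * ∑ j, derivMatrix x (ι i d) j *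
        ∑ n, sdot (z.W g k (ι i)) (Fec (z.U k (ι i)) (z.U k (Function.update (ι i) d j)) n) *
          ((m.Ja k (ι i) d n + m.Ja k (Function.update (ι i) d j) d n) / 2)) =
      ∑ i, volWeight x (ι i) * ∑ n, entropyPotential g (z.U k (ι i)) n *
        ∑ j, derivMatrix x (ι i d) j * m.Ja k (Function.update (ι i) d j) d n + _
    simp_rw [hup, hd, hv, mul_assoc (surfWeight x q), ← Finset.mul_sum]
    rw [key]
    ring
  rw [ipN_splitDiv, surfInt, sum_localFace, Finset.sum_congr rfl fun d _ => hline d,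
    Finset.sum_add_distrib, Finset.sum_comm]
  -- The potential does not depend on `d`, so it factors out of the metric identities.
  have h0 : ∑ I, ∑ d, volWeight x I * ∑ n, entropyPotential g (z.U k I) n *
      pderiv x d (fun I' => m.Ja k I' d n) I = 0 := by
    refine Finset.sum_eq_zero fun I _ => ?_
    rw [← Finset.mul_sum, Finset.sum_comm]
    simp_rw [← Finset.mul_sum, hmetric k I]
    simp
  rw [h0, zero_add]

/-! ### The entropy variables are the gradient of the entropy -/

lemma hasDerivWithinAt_pressure (g : Gas) {u : ℝ → State} {u' : State} {s : Set ℝ} {t : ℝ}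
    (hu : HasDerivWithinAt u u' s t) (h₀ : u t 0 ≠ 0) :
    HasDerivWithinAt (fun τ => pressure g (u τ))
      ((g.γ - 1) * (u' 4 - ∑ i, velocity (u t) i * u' (mom i) + u' 0 * speedSq (u t) / 2)) s t := by
  have hc := hasDerivWithinAt_pi.1 hu
  have hv : ∀ i, HasDerivWithinAt (fun τ => velocity (u τ) i)
      ((u' (mom i) * u t 0 - u t (mom i) * u' 0) / u t 0 ^ 2) s t :=
    fun i => (hc (mom i)).div (hc 0) h₀
  have hs : HasDerivWithinAt (fun τ => speedSq (u τ))
      (∑ i, 2 * velocity (u t) i * ((u' (mom i) * u t 0 - u t (mom i) * u' 0) / u t 0 ^ 2))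
      s t := by
    unfold speedSq
    refine HasDerivWithinAt.fun_sum fun i _ => ?_
    simpa using (hv i).fun_pow 2
  refine (((hc 4).sub (((hc 0).mul hs).div_const 2)).const_mul (g.γ - 1)).congr_deriv ?_
  simp only [Fin.sum_univ_three, speedSq, velocity]
  field_simp
  ring

lemma entropyVars_zero (g : Gas) (u : State) : entropyVars g u 0 =
    (g.γ - physEntropy g u) / (g.γ - 1) - u 0 * speedSq u / (2 * pressure g u) := rfl

lemma entropyVars_mom (g : Gas) (u : State) (i : Fin 3) :
    entropyVars g u (mom i) = u 0 * velocity u i / pressure g u := by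
  fin_cases i <;> rfl

lemma entropyVars_four (g : Gas) (u : State) : entropyVars g u 4 = -u 0 / pressure g u := rfl

lemma sdot_eq_mom (a b : State) : sdot a b = a 0 * b 0 + ∑ i, a (mom i) * b (mom i) + a 4 * b 4 := by
  rw [sdot, Fin.sum_univ_five, Fin.sum_univ_three]
  show _ = a 0 * b 0 + (a 1 * b 1 + a 2 * b 2 + a 3 * b 3) + a 4 * b 4
  ring

/-- Chain rule along a curve, confirming that the explicit vector `entropyVars` is `∂s/∂u`.
Derivatives within a set cover the one-sided ones at the ends of the time interval. -/
lemma hasDerivWithinAt_entropy {g : Gas} (hγ : 1 < g.γ) {u : ℝ → State} {u' : State} {s : Set ℝ}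
    {t : ℝ} (hu : HasDerivWithinAt u u' s t) (ha : Admissible g (u t)) :
    HasDerivWithinAt (fun τ => entropy g (u τ)) (sdot (entropyVars g (u t)) u') s t := by
  have hρ := ha.1.ne'
  have hp := ha.2.ne'
  have hγ' : g.γ - 1 ≠ 0 := by linarith
  have hc := hasDerivWithinAt_pi.1 hu 0
  have hP := hasDerivWithinAt_pressure g hu hρ
  have hς : HasDerivWithinAt (fun τ => physEntropy g (u τ)) _ s t :=
    (hP.log hp).sub ((hc.log hρ).const_mul g.γ)
  refine ((hc.mul hς).neg.div_const (g.γ - 1)).congr_deriv ?_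
  rw [sdot_eq_mom, entropyVars_zero, entropyVars_four]
  simp_rw [entropyVars_mom]
  have hsum : ∑ i, u t 0 * velocity (u t) i / pressure g (u t) * u' (mom i) =
      u t 0 / pressure g (u t) * ∑ i, velocity (u t) i * u' (mom i) := by
    rw [Finset.mul_sum]
    refine Finset.sum_congr rfl fun i _ => ?_
    ring
  rw [hsum]
  generalize ∑ i, velocity (u t) i * u' (mom i) = σ
  field_simp
  ring

/-! ### Viscous dissipation -/

lemma viscFlux_mom (g : Gas) (u : State) (Q : BlockVec) (i j : Fin 3) :
    viscFlux g u Q i (mom j) = stress g u Q i j := by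
  fin_cases j <;> rfl

/-- The double contraction of the stress tensor with the velocity gradient. -/
lemma sum_velGrad_mul_stress_nonneg {g : Gas} {u : State} (hμ : 0 ≤ g.μ u) (Q : BlockVec) :
    0 ≤ ∑ i, ∑ j, velGrad g u Q i j * stress g u Q i j := by
  unfold stress
  generalize velGrad g u Q = G
  -- The diagonal part uses `2 ∑ a_i² - (2/3)(∑ a_i)² = (2/3) ∑_{i<j} (a_i - a_j)²`; the coefficient
  -- 2/3 of the trace is exactly what permits this.
  have h : ∑ i, ∑ j, G i j * (g.μ u * (G i j + G j i)
        - 2 / 3 * g.μ u * (if i = j then ∑ l, G l l else 0)) =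
      g.μ u * ((G 0 1 + G 1 0) ^ 2 + (G 0 2 + G 2 0) ^ 2 + (G 1 2 + G 2 1) ^ 2
        + 2 / 3 * ((G 0 0 - G 1 1) ^ 2 + (G 0 0 - G 2 2) ^ 2 + (G 1 1 - G 2 2) ^ 2)) := by
    simp [Fin.sum_univ_three]
    ring
  rw [h]
  positivity

/-- The viscous fluxes dissipate entropy. -/
lemma sum_sdot_viscFlux_nonneg {g : Gas} (hg : g.Valid) {u : State} (hu : Admissible g u)
    (Q : BlockVec) : 0 ≤ ∑ i, sdot (Q i) (viscFlux g u Q i) := by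
  have hρ := hu.1
  have hp := hu.2
  have hμ := hg.μ_pos u hu
  have hγ : 0 < g.γ - 1 := by linarith [hg.one_lt_γ]
  have hγ₀ : 0 < g.γ := by linarith [hg.one_lt_γ]
  have hPr := hg.prandtl_pos
  have hM := hg.mach_pos
  -- Solves the quotient rule for `Q`. The part `- v_j Q_{i4}` then cancels the stress work `v · τ`
  -- in the energy flux, leaving `(ρ/p) ∇v : τ` and a square from heat conduction.
  have hQ : ∀ i j, Q i (mom j) =
      u 0 / pressure g u * velGrad g u Q i j - velocity u j * Q i 4 := by
    intro i j
    rw [velGrad, entropyVars_mom, entropyVars_four]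
    field_simp
    ring
  have h : ∀ i, sdot (Q i) (viscFlux g u Q i) =
      u 0 / pressure g u * ∑ j, velGrad g u Q i j * stress g u Q i j
        + conductivity g u * (g.γ * g.mach ^ 2) * (Q i 4 / entropyVars g u 4) ^ 2 := by
    intro i
    have h4 : viscFlux g u Q i 4 =
      (∑ j, velocity u j * stress g u Q i j) + conductivity g u * tempGrad g u Q i := rfl
    have h0 : viscFlux g u Q i 0 = 0 := rfl
    rw [sdot_eq_mom, h4, h0, tempGrad]
    simp_rw [viscFlux_mom, hQ]
    simp only [Fin.sum_univ_three]
    ring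
  simp_rw [h]
  rw [Finset.sum_add_distrib, ← Finset.mul_sum]
  have hκ : 0 ≤ conductivity g u := by unfold conductivity; positivity
  have hs := sum_velGrad_mul_stress_nonneg hμ.le Q
  refine add_nonneg (by positivity) (Finset.sum_nonneg fun i _ => by positivity)

/-! ### Entropy balance in an element and across the faces -/

/-- Reflections preserve the weights because `L_N²` is even, and exchanging coordinates only
permutes the factors; hence both sides of an interface use the same quadrature. -/
lemma IsGaussLobatto.surfWeight_act (hx : IsGaussLobatto N x) (σ : SquareSymm) (q : FaceNode N) :
    surfWeight x (σ.act q) = surfWeight x q := by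
  have h : ∀ e, weight x (σ.act q e) = weight x (q (σ.perm.symm e)) := by
    intro e
    by_cases hf : σ.flip e = true
    · have : σ.act q e = (q (σ.perm.symm e)).rev := by
        simp [SquareSymm.act, hf]
      rw [this, hx.weight_rev]
    · have : σ.act q e = q (σ.perm.symm e) := by
        simp [SquareSymm.act, hf]
      rw [this]
  unfold surfWeight
  simp_rw [h]
  exact Equiv.prod_comp σ.perm.symm fun e => weight x (q e)

namespace Snapshot

/-- Entropy production at a point of an element face. -/
noncomputable def faceProduction (z : Snapshot N K Fi Fb) (g : Gas)
    (Fec : State → State → BlockVec) (m : Mesh N K Fi Fb) (kf : K × LocalFace)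
    (q : FaceNode N) : ℝ :=
  - z.entFluxN g m kf q - sdot (z.Wtr g kf q) (z.numF g Fec m kf q - z.Fn g m kf q)
    + 1 / g.reynolds * (sdot (z.numW g m kf q) (z.Fvn g m kf q)
      + sdot (z.Wtr g kf q) (z.numFv g m kf q - z.Fvn g m kf q))

variable {z : Snapshot N K Fi Fb} {g : Gas} {Fec : State → State → BlockVec}
  {m : Mesh N K Fi Fb}

/-- Entropy estimate in one element. -/
lemma ipN_entropyVars_le (hx : IsGaussLobatto N x) (hN : 1 ≤ N) (hg : g.Valid)
    (hFec : IsEntropyConservative g Fec) (hmetric : m.MetricIdentities x)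
    (hJ : ∀ k I, 0 < m.J k I) (hz : ∀ k I, Admissible g (z.U k I)) (k : K)
    {Ut : Node N → State} (hsplit : z.SplitEq g Fec m x k Ut (z.W g k))
    (hgrad : z.GradEq g m x k (z.Fv g k)) :
    ipN x (fun I => m.J k I • Ut I) (z.W g k) ≤
      surfInt m x k (fun s => z.faceProduction g Fec m (k, s)) := by
  have hvol := ipN_splitDiv_entropyVars hx hN hFec m hmetric z hz k
  have hdiss : 0 ≤ ∑ I, volWeight x I * ∑ i, sdot (m.J k I • z.Q k I i) (z.Fv g k I i) := by
    refine Finset.sum_nonneg fun I _ => mul_nonneg (volWeight_nonneg x I) ?_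
    simp_rw [sdot_smul_left]
    rw [← Finset.mul_sum]
    exact mul_nonneg (hJ k I).le (sum_sdot_viscFlux_nonneg hg (hz k I) _)
  have hRe : 0 < 1 / g.reynolds := one_div_pos.2 hg.reynolds_pos
  have hcomm : ipN x (z.W g k) (m.stdDiv x k (z.Fv g k)) =
      ipN x (m.stdDiv x k (z.Fv g k)) (z.W g k) := by
    unfold ipN
    simp_rw [sdot_comm (z.W g k _)]
  have hsum : surfInt m x k (fun s => z.faceProduction g Fec m (k, s)) =
      - surfInt m x k (fun s q => z.entFluxN g m (k, s) q)
      - surfInt m x k (fun s q =>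
          sdot (z.W g k (s.node q)) (z.numF g Fec m (k, s) q - z.Fn g m (k, s) q))
      + 1 / g.reynolds * (surfInt m x k (fun s q =>
          sdot (z.numW g m (k, s) q) (ndot (z.Fv g k (s.node q)) (m.normal (k, s) q)))
        + surfInt m x k (fun s q =>
          sdot (z.W g k (s.node q)) (z.numFv g m (k, s) q - z.Fvn g m (k, s) q))) := by
    simp only [surfInt, faceInt, Finset.mul_sum, ← Finset.sum_add_distrib,
      ← Finset.sum_sub_distrib, ← Finset.sum_neg_distrib]
    refine Finset.sum_congr rfl fun s _ => Finset.sum_congr rfl fun q _ => ?_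
    simp only [faceProduction, Wtr, Fvn]
    ring
  unfold SplitEq at hsplit
  unfold GradEq at hgrad
  rw [hsum]
  rw [hvol] at hsplit
  -- The gradient equation tested with `F^v` turns nonnegative dissipation into an upper bound for
  -- the viscous volume term by surface terms.
  rw [hgrad, hcomm] at hdiss
  have := mul_nonneg hRe.le hdiss
  linarith

/-- With the common normal, the viscous terms cancel by `[[ab]] = {{a}}[[b]] + [[a]]{{b}}`, the
Euler terms reduce to `[[w]]ᵀF^ec - [[ψ]] = 0`, and only the `λ_max` penalty survives. -/
lemma faceProduction_left_add_right (hFec : IsEntropyConservative g Fec) (hconf : m.Conforming)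
    (hz : ∀ k I, Admissible g (z.U k I)) (f : Fi) (q : FaceNode N) :
    z.faceProduction g Fec m (m.left f) q
        + z.faceProduction g Fec m (m.right f) ((m.glue f).act q)
      = -(z.lam f q / 2 * sdot (z.jumpW g m f q) (z.jumpW g m f q)) := by
  have hL : m.across (m.left f) q =
      .inl (f, q, (m.right f).1, (m.right f).2.node ((m.glue f).act q)) := by
    simp [Mesh.across, Mesh.left]
  -- Seen from the right, `across` still returns the left index `q`, so both sides use the same `lam
  -- f q`.
  have hR : m.across (m.right f) ((m.glue f).act q) =
      .inl (f, q, (m.left f).1, (m.left f).2.node q) := by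
    simp [Mesh.across, Mesh.right]
  have hn := (hconf f q).2
  simp only [faceProduction, numF, numW, numFv, hL, hR, hn, jumpW, Fn, Fvn, entFluxN, Utr, Wtr, W]
  have haL := hz (m.left f).1 ((m.left f).2.node q)
  have haR := hz (m.right f).1 ((m.right f).2.node ((m.glue f).act q))
  generalize z.Fv g (m.left f).1 ((m.left f).2.node q) = VL
  generalize z.Fv g (m.right f).1 ((m.right f).2.node ((m.glue f).act q)) = VR
  generalize m.normal (m.left f) q = n
  generalize z.U (m.left f).1 ((m.left f).2.node q) = uL at *
  generalize z.U (m.right f).1 ((m.right f).2.node ((m.glue f).act q)) = uR at *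
  rw [surfaceFlux, surfaceFlux, hFec.symm uR uL haR haL]
  have ht := hFec.tadmor uL uR haL haR
  simp only [sdot_sub_left] at ht
  simp only [ndot_neg, sdot_neg_right, sdot_sub_left, sdot_sub_right, sdot_add_left,
    sdot_add_right, sdot_smul_left, sdot_smul_right, sdot_ndot, Pi.smul_apply, Pi.add_apply,
    Pi.neg_apply, Fin.sum_univ_three]
  linear_combination n 0 * ht 0 + n 1 * ht 1 + n 2 * ht 2

/-- Splitting `W*` as `W + (W* - W)` separates the continuous viscous boundary term from the
contribution of the numerical data. -/
lemma faceProduction_bdry (b : Fb) (q : FaceNode N) :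
    z.faceProduction g Fec m (m.bdry b) q =
      - z.entFluxN g m (m.bdry b) q
      + 1 / g.reynolds * sdot (z.Wtr g (m.bdry b) q) (z.Fvn g m (m.bdry b) q)
      - sdot (z.Wtr g (m.bdry b) q) (z.bd.Fstar b q - z.Fn g m (m.bdry b) q)
      + 1 / g.reynolds *
        (sdot (z.bd.Wstar b q - z.Wtr g (m.bdry b) q) (z.Fvn g m (m.bdry b) q)
          + sdot (z.Wtr g (m.bdry b) q) (z.bd.Fvstar b q - z.Fvn g m (m.bdry b) q)) := by
  have h : m.across (m.bdry b) q = .inr b := by simp [Mesh.across, Mesh.bdry]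
  simp only [faceProduction, numF, numW, numFv, h, sdot_sub_left]
  ring

lemma interfaceDissipation_nonneg [Fintype Fi] (hlam : ∀ f q, 0 ≤ z.lam f q) :
    0 ≤ z.interfaceDissipation g m x :=
  Finset.sum_nonneg fun f _ => Finset.sum_nonneg fun q _ =>
    mul_nonneg (mul_nonneg (surfWeight_nonneg x q)
      (mul_nonneg (div_nonneg (hlam f q) two_pos.le) (sdot_self_nonneg _))) (m.surfElem_nonneg _ _)

lemma boundaryTerms_eq_boundaryTermsExt [Fintype Fb] {lamB : Fb → FaceNode N → ℝ}
    {Uext : Fb → FaceNode N → State}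
    (h : ∀ b q, z.bd.Fstar b q =
      surfaceFlux g Fec (lamB b q) (m.normal (m.bdry b) q) (z.Utr (m.bdry b) q) (Uext b q)) :
    z.boundaryTerms g m x = z.boundaryTermsExt g Fec m x lamB Uext := by
  unfold boundaryTerms boundaryTermsExt
  refine Finset.sum_congr rfl fun b _ => ?_
  congr 1
  ext q
  have hW : entropyVars g (z.Utr (m.bdry b) q) = z.Wtr g (m.bdry b) q := rfl
  simp only [h, surfaceFlux, hW, sdot_sub_right, sdot_smul_right]
  ring

variable [Fintype K] [Fintype Fi] [Fintype Fb]

lemma sum_surfInt_faceProduction (hx : IsGaussLobatto N x)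
    (hFec : IsEntropyConservative g Fec) (hconf : m.Conforming)
    (hz : ∀ k I, Admissible g (z.U k I)) :
    ∑ k, surfInt m x k (fun s => z.faceProduction g Fec m (k, s)) =
      z.boundaryTerms g m x - z.interfaceDissipation g m x := by
  have h₁ : ∑ k, surfInt m x k (fun s => z.faceProduction g Fec m (k, s)) =
      ∑ kf : K × LocalFace, faceInt m x kf (z.faceProduction g Fec m kf) := by
    rw [Fintype.sum_prod_type]
    rfl
  rw [h₁, ← m.faces.sum_comp, Fintype.sum_sum_type, Fintype.sum_sum_type,
    ← Finset.sum_add_distrib, interfaceDissipation, boundaryTerms, add_comm, sub_eq_add_neg,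
    ← Finset.sum_neg_distrib]
  congr 1
  · refine Finset.sum_congr rfl fun b _ => ?_
    change faceInt m x (m.bdry b) (z.faceProduction g Fec m (m.bdry b)) = _
    congr 1
    ext q
    exact faceProduction_bdry b q
  · refine Finset.sum_congr rfl fun f _ => ?_
    change faceInt m x (m.left f) (z.faceProduction g Fec m (m.left f))
      + faceInt m x (m.right f) (z.faceProduction g Fec m (m.right f)) = _
    unfold faceInt
    -- Renumbering the right side by the left-hand nodes lets the two sides be paired pointwise.
    rw [← (m.glue f).act.sum_comp (fun q => surfWeight x q *
      z.faceProduction g Fec m (m.right f) q * m.surfElem (m.right f) q),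
      ← Finset.sum_add_distrib, ← Finset.sum_neg_distrib]
    refine Finset.sum_congr rfl fun q _ => ?_
    rw [hx.surfWeight_act, (hconf f q).1, ← add_mul, ← mul_add,
      faceProduction_left_add_right hFec hconf hz]
    ring

end Snapshot

/-! ### The total entropy -/

variable [Fintype K] [Fintype Fi] [Fintype Fb]

lemma IsSolution.exists_hasDerivWithinAt_totalEntropy {g : Gas} {Fec : State → State → BlockVec}
    {m : Mesh N K Fi Fb} {T : ℝ} {z : ℝ → Snapshot N K Fi Fb} (hz : IsSolution g Fec m x T z)
    (hx : IsGaussLobatto N x) (hN : 1 ≤ N) (hg : g.Valid) (hFec : IsEntropyConservative g Fec)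
    (hconf : m.Conforming) (hmetric : m.MetricIdentities x) (hJ : ∀ k I, 0 < m.J k I)
    {t : ℝ} (ht : t ∈ Set.Icc 0 T) :
    ∃ S' : ℝ, HasDerivWithinAt (fun τ => (z τ).totalEntropy g m x) S' (Set.Icc 0 T) t ∧
      S' ≤ (z t).boundaryTerms g m x - (z t).interfaceDissipation g m x := by
  obtain ⟨Ut, hUt, hsplit⟩ := hz.split_eq t ht
  have ha := hz.admissible t ht
  -- The derivative is the time term `(JU_t, W)_N` of the scheme tested with `W`.
  refine ⟨∑ k, ipN x (fun I => m.J k I • Ut k I) ((z t).W g k), ?_, ?_⟩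
  · unfold Snapshot.totalEntropy ipN
    refine HasDerivWithinAt.fun_sum fun k _ => HasDerivWithinAt.fun_sum fun I _ => ?_
    rw [sdot_smul_left, sdot_comm]
    exact ((hasDerivWithinAt_entropy hg.one_lt_γ (hUt k I) (ha k I)).const_mul _).const_mul _
  · rw [← Snapshot.sum_surfInt_faceProduction hx hFec hconf ha]
    exact Finset.sum_le_sum fun k _ => Snapshot.ipN_entropyVars_le hx hN hg hFec hmetric hJ ha k
      (hsplit k _) (hz.grad_eq t ht k _)

lemma le_of_derivWithin_nonpos {f : ℝ → ℝ} {T : ℝ} (hT : 0 ≤ T)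
    (hf : DifferentiableOn ℝ f (Set.Icc 0 T))
    (hf' : ∀ t ∈ Set.Icc 0 T, derivWithin f (Set.Icc 0 T) t ≤ 0) : f T ≤ f 0 := by
  have h : AntitoneOn f (Set.Icc 0 T) := by
    refine antitoneOn_of_deriv_nonpos (convex_Icc 0 T) hf.continuousOn
      (hf.mono interior_subset) fun t ht => ?_
    rw [← derivWithin_of_mem_nhds (mem_interior_iff_mem_nhds.1 ht)]
    exact hf' t (interior_subset ht)
  exact h (Set.left_mem_Icc.2 hT) (Set.right_mem_Icc.2 hT) hT

end DGSEM
-- The semi-discrete entropy inequality and entropy stability.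
theorem mainTheorem1 {K Fi Fb : Type*} [Fintype K] [Fintype Fi] [Fintype Fb]
    (N : ℕ) (hN : 1 ≤ N) (x : Fin (N + 1) → ℝ) (hx : DGSEM.IsGaussLobatto N x)
    (g : DGSEM.Gas) (hg : g.Valid)
    (Fec : DGSEM.State → DGSEM.State → DGSEM.BlockVec)
    (hFec : DGSEM.IsEntropyConservative g Fec)
    (m : DGSEM.Mesh N K Fi Fb) (hconf : m.Conforming) (hmetric : m.MetricIdentities x)
    (hJ : ∀ k I, 0 < m.J k I)
    (T : ℝ) (hT : 0 < T) (z : ℝ → DGSEM.Snapshot N K Fi Fb)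
    (hz : DGSEM.IsSolution g Fec m x T z) :
    -- the total discrete entropy is differentiable in time and obeys the entropy estimate
    DifferentiableOn ℝ (fun t => (z t).totalEntropy g m x) (Set.Icc 0 T) ∧
    (∀ t ∈ Set.Icc 0 T,
      derivWithin (fun τ => (z τ).totalEntropy g m x) (Set.Icc 0 T) t ≤
        (z t).boundaryTerms g m x - (z t).interfaceDissipation g m x) ∧
    -- the same with the advective boundary flux built from exterior states
    (∀ t ∈ Set.Icc 0 T, ∀ (lamB : Fb → DGSEM.FaceNode N → ℝ)
      (Uext : Fb → DGSEM.FaceNode N → DGSEM.State),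
      (∀ b q, (z t).bd.Fstar b q =
        DGSEM.surfaceFlux g Fec (lamB b q) (m.normal (m.bdry b) q)
          ((z t).Utr (m.bdry b) q) (Uext b q)) →
      derivWithin (fun τ => (z τ).totalEntropy g m x) (Set.Icc 0 T) t ≤
        (z t).boundaryTermsExt g Fec m x lamB Uext - (z t).interfaceDissipation g m x) ∧
    -- boundary data for which the physical boundary terms do not increase the entropy
    ((∀ t ∈ Set.Icc 0 T, (z t).boundaryTerms g m x ≤ 0) →
      (∀ t ∈ Set.Icc 0 T,
        derivWithin (fun τ => (z τ).totalEntropy g m x) (Set.Icc 0 T) t ≤ 0) ∧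
      (z T).totalEntropy g m x ≤ (z 0).totalEntropy g m x) ∧
    -- periodic problems: there are no physical boundary faces
    (IsEmpty Fb →
      (∀ t ∈ Set.Icc 0 T,
        derivWithin (fun τ => (z τ).totalEntropy g m x) (Set.Icc 0 T) t ≤ 0) ∧
      (z T).totalEntropy g m x ≤ (z 0).totalEntropy g m x) := by
  have hex := fun t (ht : t ∈ Set.Icc 0 T) =>
    hz.exists_hasDerivWithinAt_totalEntropy hx hN hg hFec hconf hmetric hJ ht
  have hdiff : DifferentiableOn ℝ (fun t => (z t).totalEntropy g m x) (Set.Icc 0 T) :=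
    fun t ht => (hex t ht).choose_spec.1.differentiableWithinAt
  have hle : ∀ t ∈ Set.Icc 0 T,
      derivWithin (fun τ => (z τ).totalEntropy g m x) (Set.Icc 0 T) t ≤
        (z t).boundaryTerms g m x - (z t).interfaceDissipation g m x := by
    intro t ht
    obtain ⟨S', hS, hS'⟩ := hex t ht
    -- Positivity of `T` makes derivatives within `[0, T]` unique, including at the end points.
    rwa [hS.derivWithin (uniqueDiffOn_Icc hT t ht)]
  have hstable : (∀ t ∈ Set.Icc 0 T, (z t).boundaryTerms g m x ≤ 0) →
      (∀ t ∈ Set.Icc 0 T,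
        derivWithin (fun τ => (z τ).totalEntropy g m x) (Set.Icc 0 T) t ≤ 0) ∧
      (z T).totalEntropy g m x ≤ (z 0).totalEntropy g m x := by
    intro hb
    have hneg : ∀ t ∈ Set.Icc 0 T,
        derivWithin (fun τ => (z τ).totalEntropy g m x) (Set.Icc 0 T) t ≤ 0 := fun t ht => by
      have h₁ := hle t ht
      have h₂ := hb t ht
      have h₃ := DGSEM.Snapshot.interfaceDissipation_nonneg (g := g) (m := m) (x := x)
        (hz.lam_nonneg t ht)
      linarith
    exact ⟨hneg, DGSEM.le_of_derivWithin_nonpos hT.le hdiff hneg⟩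
  refine ⟨hdiff, hle, fun t ht lamB Uext h => ?_, hstable, fun hE => hstable fun t _ => ?_⟩
  · rw [← DGSEM.Snapshot.boundaryTerms_eq_boundaryTermsExt h]
    exact hle t ht
  · simp [DGSEM.Snapshot.boundaryTerms]
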